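/- Theorem 1.2. Let $I=[0,1)$ and let $k\ge 1$ be an integer. Let $\boldsymbol a=(a_0,a_1,\ldots,a_{k-1})\in\mathbb{R}^k$ satisfy $0=a_0<a_1<\cdots<a_{k-1}<1$, put $a_k=1$, and let $\boldsymbol b=(b_1,\ldots,b_k)\in\mathbb{R}^k$. Assume that $\boldsymbol a$ and $\boldsymbol b$ are $\mathbb{Z}$-independent, that is, $a_i-b_j\notin\mathbb{Z}$ for all $0\le i\le k-1$ and $1\le j\le k$. For $0<\lambda<1$ let $F_\lambda:I\to\mathbb{R}$ be given by $F_\lambda(x)=\lambda x+b_i$ for $x\in[a_{i-1},a_i)$, $1\le i\le k$, and let $f_\lambda:I\to I$ be the piecewise $\lambda$-affine map $f_\lambda(x)=F_\lambda(x) \pmod 1$, i.e. the fractional part of $F_\lambda(x)$. For a map $f:I\to I$ and $x\in I$ let $\omega(f,x)\subset[0,1]$ be the set of all limits in $\mathbb{R}$ of subsequences of $(f^n(x))_{n\ge 0}$, and let $\omega(f)=\bigcup_{x\in I}\omega(f,x)$. A periodic orbit is a set $\{f^n(z):n\ge 0\}$ with $z\in I$ and $f^p(z)=z$ for some $p\ge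 1$. The map $f$ is called asymptotically periodic if $\omega(f,x)$ is a periodic orbit for every $x\in I$ and $\omega(f)$ is a union of finitely many periodic orbits. Then the set $$\{\lambda\in(0,1) : f_\lambda \text{ is not asymptotically periodic}\}$$ has Hausdorff dimension zero. -/

import Mathlib

namespace PiecewiseAffine

/-- The half-open unit interval `I = [0, 1)`. -/
abbrev I : Type := Set.Ico (0 : ℝ) 1

/-- The `ω`-limit set of the point `x` under `f : I → I`: the set of all real limits of
subsequences of the orbit `f^n(x)`. The closures are taken in `ℝ`, so the endpoint `1`
belongs to it when the orbit accumulates at `1`. -/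
def omega (f : I → I) (x : I) : Set ℝ :=
  omegaLimit Filter.atTop (fun (n : ℕ) (y : I) => ((f^[n] y : I) : ℝ)) {x}

/-- `P` is the orbit of a periodic point of `f : I → I`. -/
def IsPeriodicOrbit (f : I → I) (P : Set ℝ) : Prop :=
  ∃ z ∈ Function.periodicPts f, P = Set.range (fun n : ℕ => ((f^[n] z : I) : ℝ))

/-- `f` is asymptotically periodic: every `ω`-limit set `ω(f, x)` is a periodic orbit, and
`ω(f) = ⋃ₓ ω(f, x)` consists of finitely many periodic orbits. -/
def AsymptoticallyPeriodic (f : I → I) : Prop :=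
  (∀ x : I, IsPeriodicOrbit f (omega f x)) ∧
    ∃ O : Set (Set ℝ), O.Finite ∧ (∀ P ∈ O, IsPeriodicOrbit f P) ∧ (⋃ x : I, omega f x) = ⋃₀ O

/-- The set `A^(k)` of tuples `(0, a_1, …, a_{k-1})` with `0 < a_1 < ⋯ < a_{k-1} < 1`,
indexed by `Fin k`. -/
def partitionPoints (k : ℕ) : Set (Fin k → ℝ) :=
  {a | (∀ i, i.val = 0 → a i = 0) ∧ StrictMono a ∧ ∀ i, a i < 1}

/-- The right endpoint of the piece that starts at `a i`: the next partition point, or `1`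
for the last piece. -/
def rightEnd {k : ℕ} (a : Fin k → ℝ) (i : Fin k) : ℝ :=
  if h : i.val + 1 < k then a ⟨i.val + 1, h⟩ else 1

/-- The `k`-interval piecewise `l`-affine function `F(x) = l x + b i` for `x` in the `i`-th
piece `[a i, rightEnd a i)`. -/
noncomputable def affineF {k : ℕ} (a b : Fin k → ℝ) (l : ℝ) (x : I) : ℝ :=
  l * (x : ℝ) + ∑ i : Fin k, (Set.Ico (a i) (rightEnd a i)).indicator (fun _ => b i) (x : ℝ)

/-- For `a ∈ A^(k)` the pieces are disjoint, so `affineF` is given by the expected formula. -/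
theorem affineF_eq {k : ℕ} {a : Fin k → ℝ} (ha : a ∈ partitionPoints k) (b : Fin k → ℝ) (l : ℝ)
    (x : I) (i : Fin k) (hx : (x : ℝ) ∈ Set.Ico (a i) (rightEnd a i)) :
    affineF a b l x = l * (x : ℝ) + b i := by
  have key : ∀ p q : Fin k, p < q → rightEnd a p ≤ a q := by
    intro p q hpq
    have h : p.val + 1 < k := lt_of_le_of_lt hpq q.isLt
    rw [rightEnd, dif_pos h]
    exact ha.2.1.monotone hpq
  unfold affineF
  rw [Finset.sum_eq_single i, Set.indicator_of_mem hx]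
  · intro j _ hj
    refine Set.indicator_of_notMem (fun hj' => ?_) _
    rcases lt_or_gt_of_ne hj with h | h
    · exact absurd (key j i h) (not_le.2 (lt_of_le_of_lt hx.1 hj'.2))
    · exact absurd (key i j h) (not_le.2 (lt_of_le_of_lt hj'.1 hx.2))
  · simp

/-- The piecewise `l`-affine map `f = F (mod 1) : I → I`. -/
noncomputable def affineMap {k : ℕ} (a b : Fin k → ℝ) (l : ℝ) (x : I) : I :=
  ⟨Int.fract (affineF a b l x), Int.fract_nonneg _, Int.fract_lt_one _⟩

/-- `x` and `y` are `ℤ`-independent: no difference `x i - y j` is an integer. -/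
def ZIndependent {k : ℕ} (x y : Fin k → ℝ) : Prop :=
  ∀ (i j : Fin k) (n : ℤ), x i - y j ≠ (n : ℝ)

/-- The set of slopes `l ∈ (0, 1)` for which the map is not asymptotically periodic. -/
def exceptionalSlopes {k : ℕ} (a b : Fin k → ℝ) : Set ℝ :=
  {l | l ∈ Set.Ioo (0 : ℝ) 1 ∧ ¬ AsymptoticallyPeriodic (affineMap a b l)}

end PiecewiseAffine

/-!
The map `f` with slope `l` acts by branches `y ↦ l * y + e`, where the digit `e` ranges over a
finite set that does not depend on `l`. On the circle `f` can only be discontinuous at the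
endpoints of the pieces.

If all orbits eventually stay at a distance at least `η` from the endpoints, then `f` contracts
distances below `η` along these orbits, every orbit is attracted by a periodic one, and there are
finitely many of these (`asymptoticallyPeriodic_of_far`). So for an exceptional slope and every `n`
some `f^[n] x` is within `l ^ n` of an endpoint `t`. This point is, up to `l ^ n`, the value at `l`
of a polynomial whose coefficients are the digits of `x`; thus `l` is a near-zero of that polynomial
minus `t`, whose constant coefficient is a digit minus `t`. By `ℤ`-independence that coefficient is
bounded away from zero, and then the near-zeros in `[0, r]`, `r < 1`, lie in `M` intervals of length
about `r ^ (n / M)` with `M` depending only on `r` (`separation_pow_le`, a Schwarz lemma applied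
after subtracting a Lagrange interpolant).

It remains to count itineraries. Countably many slopes are discarded: those with a connection, that
is, a composition of branches mapping an endpoint to an endpoint
(`countable_connections`, again by `ℤ`-independence). Near any other slope a short interval is cut
at most once in `m` steps, for after a cut both sides follow the orbit of an endpoint, which does
not meet another endpoint (`exists_card_le_two_eventually_itinerary_mem`). Hence the itineraries of
all nearby slopes together at most double every `m` steps (`exists_itinerary_growth`). Since `m` is
arbitrary, this growth loses against `r ^ (n d / M)` for every `d > 0`, so the exceptional slopes
have `d`-dimensional Hausdorff measure zero near each slope without connections
(`exists_hausdorffMeasure_eq_zero`), and the dimension is determined locally.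
-/

namespace PiecewiseAffine

open Filter Topology Polynomial MeasureTheory
open scoped NNReal ENNReal

variable {k : ℕ} {a b : Fin k → ℝ} {l : ℝ}

/-! ### Separated near-zeros of polynomials with bounded coefficients -/

theorem norm_aeval_le_of_coeff_le {g : ℝ[X]} {B R : ℝ} (hB : ∀ j, |g.coeff j| ≤ B)
    (hR0 : 0 ≤ R) (hR : R < 1) {z : ℂ} (hz : ‖z‖ ≤ R) : ‖aeval z g‖ ≤ B / (1 - R) := by
  have hB0 : 0 ≤ B := (abs_nonneg _).trans (hB 0)
  rw [aeval_eq_sum_range]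
  calc ‖∑ i ∈ Finset.range (g.natDegree + 1), g.coeff i • z ^ i‖
      ≤ ∑ i ∈ Finset.range (g.natDegree + 1), B * R ^ i := by
        refine norm_sum_le_of_le _ fun i _ => ?_
        rw [norm_smul, norm_pow, Real.norm_eq_abs]
        exact mul_le_mul (hB i) (pow_le_pow_left₀ (norm_nonneg _) hz i) (by positivity) hB0
    _ = B * ∑ i ∈ Finset.range (g.natDegree + 1), R ^ i := by rw [Finset.mul_sum]
    _ ≤ B * (1 - R)⁻¹ := by
        refine mul_le_mul_of_nonneg_left ?_ hB0
        rw [← tsum_geometric_of_lt_one hR0 hR]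
        exact (summable_geometric_of_lt_one hR0 hR).sum_le_tsum _ fun i _ => by positivity
    _ = B / (1 - R) := by rw [div_eq_mul_inv]

/-- A form of the Schwarz lemma for several zeros: the linear factors `z - x` of a polynomial are
traded for `(R ^ 2 - x z) / R`, which have the same modulus on the circle `‖z‖ = R`, and the
maximum principle is applied to the resulting polynomial. -/
theorem norm_aeval_zero_mul_pow_le {q : ℝ[X]} {s : Finset ℝ} {R A : ℝ} (hR : 0 < R)
    (hA : ∀ z : ℂ, ‖z‖ = R → ‖(∏ x ∈ s, (z - (x : ℂ))) * aeval z q‖ ≤ A) :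
    ‖aeval (0 : ℂ) q‖ * R ^ s.card ≤ A := by
  set G : ℂ → ℂ := fun z => (∏ x ∈ s, (((R : ℂ) ^ 2 - x * z) / R)) * aeval z q with hG
  have hRc : (R : ℂ) ≠ 0 := by exact_mod_cast hR.ne'
  have hdiff : Differentiable ℂ G := by
    refine Differentiable.mul ?_ (Polynomial.differentiable_aeval q)
    refine Differentiable.fun_finsetProd fun x _ => ?_
    fun_prop
  have hbd : ∀ z ∈ frontier (Metric.ball (0 : ℂ) R), ‖G z‖ ≤ A := by
    intro z hz
    rw [frontier_ball _ hR.ne', mem_sphere_zero_iff_norm] at hz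
    refine le_trans (le_of_eq ?_) (hA z hz)
    rw [hG, norm_mul, norm_mul, norm_prod, norm_prod]
    congr 1
    refine Finset.prod_congr rfl fun x _ => ?_
    have h1 : (R : ℂ) ^ 2 = z * (starRingEnd ℂ) z := by
      rw [Complex.mul_conj, Complex.normSq_eq_norm_sq, hz]; push_cast; rfl
    have h2 : (R : ℂ) ^ 2 - x * z = z * (starRingEnd ℂ) (z - x) := by
      rw [h1, map_sub, Complex.conj_ofReal]; ring
    rw [h2, norm_div, norm_mul, Complex.norm_conj, hz, Complex.norm_real, Real.norm_eq_abs,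
      abs_of_pos hR]
    field_simp
  have h0 := Complex.norm_le_of_forall_mem_frontier_norm_le Metric.isBounded_ball
    hdiff.diffContOnCl hbd (subset_closure (Metric.mem_ball_self hR))
  refine le_trans (le_of_eq ?_) h0
  rw [hG]
  have : ∀ x ∈ s, (((R : ℂ) ^ 2 - x * 0) / R) = R := fun x _ => by field_simp; ring
  simp only [Finset.prod_congr rfl this, Finset.prod_const, norm_mul, norm_pow, Complex.norm_real,
    Real.norm_eq_abs, abs_of_pos hR]
  ring

theorem norm_aeval_interpolate_le {g : ℝ[X]} {s : Finset ℝ} {t ε : ℝ} (ht : 0 < t) (ht1 : t ≤ 1)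
    (hε : 0 ≤ ε) (hs1 : ∀ x ∈ s, |x| ≤ 1) (hsep : ∀ x ∈ s, ∀ y ∈ s, x ≠ y → t ≤ |x - y|)
    (hg : ∀ x ∈ s, |g.eval x| ≤ ε) {z : ℂ} (hz : ‖z‖ ≤ 1) :
    ‖aeval z (Lagrange.interpolate s id fun x => g.eval x)‖ ≤ s.card * ε * (2 / t) ^ s.card := by
  rw [Lagrange.interpolate_apply, map_sum]
  have h2t : 1 ≤ 2 / t := by rw [le_div_iff₀ ht]; linarith
  calc _ ≤ ∑ x ∈ s, ε * (2 / t) ^ s.card := by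
        refine norm_sum_le_of_le _ fun x hx => ?_
        rw [map_mul, aeval_C, norm_mul]
        refine mul_le_mul ?_ ?_ (norm_nonneg _) hε
        · simpa using hg x hx
        rw [Lagrange.basis, map_prod, norm_prod]
        calc _ ≤ ∏ y ∈ s.erase x, (2 / t) := by
              refine Finset.prod_le_prod (fun _ _ => norm_nonneg _) fun y hy => ?_
              have hxy : t ≤ |x - y| :=
                hsep x hx y (Finset.mem_of_mem_erase hy) (Finset.ne_of_mem_erase hy).symm
              rw [Lagrange.basisDivisor, map_mul, aeval_C, norm_mul, map_sub, aeval_X, aeval_C]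
              simp only [id, Complex.coe_algebraMap, Complex.norm_real, Real.norm_eq_abs, abs_inv]
              rw [div_eq_inv_mul]
              refine mul_le_mul (inv_anti₀ ht hxy) ?_ (norm_nonneg _) (by positivity)
              refine (norm_sub_le _ _).trans ?_
              rw [Complex.norm_real, Real.norm_eq_abs]
              linarith [hs1 y (Finset.mem_of_mem_erase hy)]
          _ = (2 / t) ^ (s.erase x).card := by rw [Finset.prod_const]
          _ ≤ (2 / t) ^ s.card := pow_le_pow_right₀ h2t (Finset.card_le_card (s.erase_subset x))
    _ = _ := by rw [Finset.sum_const, nsmul_eq_mul]; ring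

/-- A polynomial with coefficients at most `B` and constant coefficient at least `δ` cannot be
smaller than `ε` at `M` well separated points of `[0, r]`, where `M` depends only on
`B`, `δ` and `r < R < 1`. -/
theorem separation_pow_le {g : ℝ[X]} {B δ r R t ε : ℝ} (hB : ∀ j, |g.coeff j| ≤ B)
    (hδ : δ ≤ |g.coeff 0|) (hrR : r ≤ R) (hR0 : 0 < R) (hR : R < 1)
    {s : Finset ℝ} (hs : ∀ x ∈ s, x ∈ Set.Icc 0 r) (ht : 0 < t) (ht1 : t ≤ 1) (hε : 0 ≤ ε)
    (hsep : ∀ x ∈ s, ∀ y ∈ s, x ≠ y → t ≤ |x - y|) (hg : ∀ x ∈ s, |g.eval x| ≤ ε)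
    (hM : B / (1 - R) * (r / R) ^ s.card ≤ δ / 2) :
    δ * t ^ s.card ≤ 4 * s.card * ε * 2 ^ s.card := by
  have e1 : ‖aeval (0 : ℂ) g‖ = |g.coeff 0| := by
    rw [← coeff_zero_eq_aeval_zero' g, Complex.coe_algebraMap, Complex.norm_real, Real.norm_eq_abs]
  rcases s.eq_empty_or_nonempty with rfl | ⟨x₀, hx₀⟩
  · have h0 := norm_aeval_le_of_coeff_le hB hR0.le hR (z := 0) (by simpa using hR0.le)
    have : 0 ≤ B / (1 - R) := (norm_nonneg _).trans h0
    simp only [Finset.card_empty, pow_zero, mul_one, Nat.cast_zero] at hM ⊢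
    linarith
  have hr0 : 0 ≤ r := (hs x₀ hx₀).1.trans (hs x₀ hx₀).2
  set p := Lagrange.interpolate s id fun x => g.eval x with hp
  set P : ℝ := s.card * ε * (2 / t) ^ s.card with hP
  have hP0 : 0 ≤ P := by positivity
  have hpz : ∀ z : ℂ, ‖z‖ ≤ 1 → ‖aeval z p‖ ≤ P := fun z hz =>
    norm_aeval_interpolate_le ht ht1 hε
      (fun x hx => abs_le.2 ⟨by linarith [(hs x hx).1], by linarith [(hs x hx).2]⟩) hsep hg hz
  obtain ⟨q, hq⟩ : (∏ x ∈ s, (X - C x)) ∣ g - p := by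
    refine Finset.prod_dvd_of_coprime
      (fun x _ y _ hxy => pairwise_coprime_X_sub_C Function.injective_id hxy) fun x hx => ?_
    rw [dvd_iff_isRoot, IsRoot.def, eval_sub, sub_eq_zero]
    exact (Lagrange.eval_interpolate_at_node (fun x => g.eval x) Function.injective_id.injOn hx).symm
  have hqz : ∀ z : ℂ, (∏ x ∈ s, (z - (x : ℂ))) * aeval z q = aeval z g - aeval z p := by
    intro z
    have := congrArg (aeval z) hq
    rw [map_sub, map_mul, map_prod] at this
    rw [this]
    simp
  have hB1 : 0 ≤ B / (1 - R) :=
    div_nonneg ((abs_nonneg _).trans (hB 0)) (by linarith)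
  have hq0 := norm_aeval_zero_mul_pow_le (q := q) (s := s) hR0 (A := B / (1 - R) + P) (by
    intro z hz
    rw [hqz]
    exact (norm_sub_le _ _).trans
      (add_le_add (norm_aeval_le_of_coeff_le hB hR0.le hR hz.le) (hpz z (hz.le.trans hR.le))))
  have hprod : ‖∏ x ∈ s, ((0 : ℂ) - (x : ℂ))‖ ≤ r ^ s.card := by
    rw [norm_prod, ← Finset.prod_const]
    refine Finset.prod_le_prod (fun _ _ => norm_nonneg _) fun x hx => ?_
    rw [zero_sub, norm_neg, Complex.norm_real, Real.norm_eq_abs, abs_of_nonneg (hs x hx).1]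
    exact (hs x hx).2
  have hfin : δ ≤ (B / (1 - R) + P) * (r / R) ^ s.card + P := by
    have e0 : aeval (0 : ℂ) g = (∏ x ∈ s, ((0 : ℂ) - (x : ℂ))) * aeval 0 q + aeval 0 p := by
      rw [hqz]; ring
    refine hδ.trans ?_
    rw [← e1, e0]
    refine (norm_add_le _ _).trans (add_le_add ?_ (hpz 0 (by simp)))
    rw [norm_mul, div_pow, ← mul_div_assoc, le_div_iff₀ (by positivity), mul_assoc, mul_comm]
    exact mul_le_mul hq0 hprod (norm_nonneg _) (add_nonneg hB1 hP0)
  have hle1 : (r / R) ^ s.card ≤ 1 := pow_le_one₀ (by positivity) ((div_le_one hR0).2 hrR)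
  have h4 : δ ≤ 4 * P := by nlinarith [mul_le_mul_of_nonneg_left hle1 hP0]
  rw [hP, div_pow] at h4
  have ht' : 0 < t ^ s.card := by positivity
  calc δ * t ^ s.card ≤ (4 * (s.card * ε * (2 ^ s.card / t ^ s.card))) * t ^ s.card :=
        mul_le_mul_of_nonneg_right h4 ht'.le
    _ = _ := by field_simp

/-- A set without `M` points at mutual distance at least `t` is covered by at most `M` balls
of radius `t` (take a maximal separated subset). -/
theorem exists_finset_cover_of_separated {S : Set ℝ} {t : ℝ} (ht : 0 ≤ t) {M : ℕ}
    (h : ∀ s : Finset ℝ, (∀ x ∈ s, x ∈ S) → (∀ x ∈ s, ∀ y ∈ s, x ≠ y → t ≤ |x - y|) →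
      s.card ≠ M) :
    ∃ F : Finset ℝ, F.card ≤ M ∧ S ⊆ ⋃ x ∈ F, Metric.closedBall x t := by
  by_contra! hcon
  have key : ∀ n ≤ M, ∃ s : Finset ℝ, (∀ x ∈ s, x ∈ S) ∧
      (∀ x ∈ s, ∀ y ∈ s, x ≠ y → t ≤ |x - y|) ∧ s.card = n := by
    intro n
    induction n with
    | zero => exact fun _ => ⟨∅, by simp, by simp, rfl⟩
    | succ n ih =>
      intro hn
      obtain ⟨s, hs, hsep, hc⟩ := ih (by omega)
      obtain ⟨y, hyS, hy⟩ := Set.not_subset.1 (hcon s (by omega))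
      simp only [Set.mem_iUnion, Metric.mem_closedBall, not_exists, not_le, Real.dist_eq] at hy
      have hys : y ∉ s := fun hys => by
        have := hy y hys
        simp at this
        linarith
      refine ⟨insert y s, ?_, ?_, by rw [Finset.card_insert_of_notMem hys, hc]⟩
      · intro x hx
        rcases Finset.mem_insert.1 hx with rfl | hx
        exacts [hyS, hs x hx]
      · intro x hx x' hx' hne
        rw [Finset.mem_insert] at hx hx'
        by_cases h1 : x = y
        · subst h1
          exact (hy x' (hx'.resolve_left hne.symm)).le
        by_cases h2 : x' = y
        · subst h2
          rw [abs_sub_comm]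
          exact (hy x (hx.resolve_left h1)).le
        exact hsep x (hx.resolve_left h1) x' (hx'.resolve_left h2) hne
  obtain ⟨s, hs, hsep, hc⟩ := key M le_rfl
  exact h s hs hsep hc

/-! ### The pieces of the map -/

/-- The endpoints of the pieces: the partition points together with `1`. On the circle these are
the only possible discontinuities of the map. -/
noncomputable def targets (a : Fin k → ℝ) : Finset ℝ :=
  insert 1 (Finset.univ.image a)

theorem one_mem_targets : (1 : ℝ) ∈ targets a := Finset.mem_insert_self _ _

theorem apply_mem_targets (i : Fin k) : a i ∈ targets a :=
  Finset.mem_insert_of_mem (Finset.mem_image_of_mem _ (Finset.mem_univ i))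

theorem zero_mem_targets (hk : 0 < k) (ha : a ∈ partitionPoints k) : (0 : ℝ) ∈ targets a := by
  rw [← ha.1 ⟨0, hk⟩ rfl]
  exact apply_mem_targets _

theorem rightEnd_mem_targets (i : Fin k) : rightEnd a i ∈ targets a := by
  unfold rightEnd
  split_ifs with h
  exacts [apply_mem_targets _, one_mem_targets]

theorem nonneg_of_mem_partitionPoints (hk : 0 < k) (ha : a ∈ partitionPoints k) (i : Fin k) :
    0 ≤ a i := by
  rw [← ha.1 ⟨0, hk⟩ rfl]
  exact ha.2.1.monotone (Fin.mk_le_of_le_val (Nat.zero_le _))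

theorem mem_Icc_of_mem_targets (hk : 0 < k) (ha : a ∈ partitionPoints k) {t : ℝ}
    (ht : t ∈ targets a) : t ∈ Set.Icc (0 : ℝ) 1 := by
  rcases Finset.mem_insert.1 ht with rfl | ht
  · exact ⟨zero_le_one, le_rfl⟩
  obtain ⟨i, -, rfl⟩ := Finset.mem_image.1 ht
  exact ⟨nonneg_of_mem_partitionPoints hk ha i, (ha.2.2 i).le⟩

theorem exists_mem_piece (hk : 0 < k) (ha : a ∈ partitionPoints k) {x : ℝ}
    (hx : x ∈ Set.Ico (0 : ℝ) 1) : ∃ i, x ∈ Set.Ico (a i) (rightEnd a i) := by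
  have hne : (Finset.univ.filter fun i => a i ≤ x).Nonempty :=
    ⟨⟨0, hk⟩, by simpa [ha.1 ⟨0, hk⟩ rfl] using hx.1⟩
  obtain ⟨i, hi, hmax⟩ := Finset.exists_max_image _ id hne
  refine ⟨i, (Finset.mem_filter.1 hi).2, ?_⟩
  unfold rightEnd
  split_ifs with h
  · by_contra! hle
    have := hmax ⟨i.val + 1, h⟩ (Finset.mem_filter.2 ⟨Finset.mem_univ _, hle⟩)
    simp [Fin.le_def] at this
  · exact hx.2

theorem affineMap_eq_fract (ha : a ∈ partitionPoints k) {x : I} {i : Fin k}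
    (hx : (x : ℝ) ∈ Set.Ico (a i) (rightEnd a i)) :
    (affineMap a b l x : ℝ) = Int.fract (l * x + b i) := by
  change Int.fract (affineF a b l x) = _
  rw [affineF_eq ha b l x i hx]

theorem affineMap_eq_fract_fract (ha : a ∈ partitionPoints k) {x : I} {i : Fin k}
    (hx : (x : ℝ) ∈ Set.Ico (a i) (rightEnd a i)) :
    (affineMap a b l x : ℝ) = Int.fract (l * x + Int.fract (b i)) := by
  rw [affineMap_eq_fract ha hx, Int.fract_eq_fract]
  exact ⟨⌊b i⌋, by rw [Int.fract]; ring⟩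

/-- Away from the endpoints, `f` is affine with slope `l` at scales below `η`. Only the image of `y`
has to be away from `0` and `1`: this excludes that the interval between the images of `y` and `z`
crosses an integer. -/
theorem affineMap_sub_eq (hk : 0 < k) (ha : a ∈ partitionPoints k) (hl0 : 0 ≤ l) (hl1 : l ≤ 1)
    {η : ℝ} {y z : I} (hz : ∀ t ∈ targets a, η ≤ |(z : ℝ) - t|)
    (hfy : ∀ t ∈ targets a, η ≤ |(affineMap a b l y : ℝ) - t|) (hyz : |(y : ℝ) - z| < η) :
    (affineMap a b l z : ℝ) - affineMap a b l y = l * (z - y) := by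
  obtain ⟨i, hi⟩ := exists_mem_piece hk ha z.2
  have h1 := hz _ (apply_mem_targets i)
  have h2 := hz _ (rightEnd_mem_targets i)
  rw [abs_of_nonneg (by linarith [hi.1])] at h1
  rw [abs_of_neg (by linarith [hi.2])] at h2
  have hyz' := abs_lt.1 hyz
  have hyi : (y : ℝ) ∈ Set.Ico (a i) (rightEnd a i) := ⟨by linarith, by linarith⟩
  have h3 := hfy _ (zero_mem_targets hk ha)
  have h4 := hfy _ one_mem_targets
  rw [sub_zero, abs_of_nonneg (affineMap a b l y).2.1] at h3
  rw [abs_of_neg (by linarith [(affineMap a b l y).2.2])] at h4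
  have h5 : |l * (z - y : ℝ)| < η := by
    rw [abs_mul, abs_of_nonneg hl0, abs_sub_comm]
    exact (mul_le_of_le_one_left (abs_nonneg _) hl1).trans_lt hyz
  have h5' := abs_lt.1 h5
  have hfy' : (affineMap a b l y : ℝ) = l * y + b i - ⌊l * y + b i⌋ :=
    affineMap_eq_fract ha hyi
  rw [affineMap_eq_fract ha hi, sub_eq_iff_eq_add, Int.fract_eq_iff]
  exact ⟨by linarith, by linarith, ⌊l * y + b i⌋, by rw [hfy']; ring⟩

/-! ### Orbits staying away from the endpoints of the pieces -/

/-- The points whose whole orbit stays at distance at least `η` from the endpoints of the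
pieces. -/
def awaySet (a b : Fin k → ℝ) (l η : ℝ) : Set I :=
  {z | ∀ j, ∀ t ∈ targets a, η ≤ |((affineMap a b l)^[j] z : ℝ) - t|}

theorem iterate_mem_awaySet {η : ℝ} {z : I} (hz : z ∈ awaySet a b l η) (n : ℕ) :
    (affineMap a b l)^[n] z ∈ awaySet a b l η := fun j t ht => by
  rw [← Function.iterate_add_apply]
  exact hz _ t ht

theorem iterate_sub_iterate (hk : 0 < k) (ha : a ∈ partitionPoints k) (hl0 : 0 ≤ l) (hl1 : l ≤ 1)
    {η : ℝ} {y z : I} (hy : y ∈ awaySet a b l η) (hz : z ∈ awaySet a b l η)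
    (hyz : |(y : ℝ) - z| < η) (j : ℕ) :
    ((affineMap a b l)^[j] z : ℝ) - (affineMap a b l)^[j] y = l ^ j * (z - y) := by
  induction j with
  | zero => simp
  | succ j ih =>
    have hfy := hy (j + 1)
    rw [Function.iterate_succ_apply'] at hfy
    rw [Function.iterate_succ_apply', Function.iterate_succ_apply',
      affineMap_sub_eq hk ha hl0 hl1 (hz j) hfy, ih]
    · ring
    · rw [abs_sub_comm, ih, abs_mul, abs_of_nonneg (pow_nonneg hl0 j), abs_sub_comm]
      exact (mul_le_of_le_one_left (abs_nonneg _) (pow_le_one₀ hl0 hl1)).trans_lt hyz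

theorem tendsto_iterate_of_mem_awaySet (hk : 0 < k) (ha : a ∈ partitionPoints k) (hl0 : 0 ≤ l)
    (hl1 : l ≤ 1) {η : ℝ} (hη : 0 < η) {y : ℕ → I} (hy : ∀ q, y q ∈ awaySet a b l η) {z : I}
    (hyz : Tendsto (fun q => (y q : ℝ)) atTop (𝓝 z)) (j : ℕ) :
    Tendsto (fun q => ((affineMap a b l)^[j] (y q) : ℝ)) atTop (𝓝 ((affineMap a b l)^[j] z)) := by
  induction j with
  | zero => exact hyz
  | succ j ih =>
    have hfar : ∀ t ∈ targets a, η ≤ |((affineMap a b l)^[j] z : ℝ) - t| := fun t ht =>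
      ge_of_tendsto' (ih.sub_const t).abs fun q => hy q j t ht
    have hev : ∀ᶠ q in atTop, ((affineMap a b l)^[j + 1] z : ℝ) -
        l * (((affineMap a b l)^[j] z : ℝ) - (affineMap a b l)^[j] (y q)) =
          (affineMap a b l)^[j + 1] (y q) := by
      have := (ih.sub_const ((affineMap a b l)^[j] z : ℝ)).abs
      rw [sub_self, abs_zero] at this
      filter_upwards [this.eventually_lt_const hη] with q hq
      have hfy := hy q (j + 1)
      rw [Function.iterate_succ_apply'] at hfy
      rw [← affineMap_sub_eq hk ha hl0 hl1 hfar hfy hq, Function.iterate_succ_apply',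
        Function.iterate_succ_apply']
      ring
    refine Tendsto.congr' hev ?_
    simpa using ((ih.const_sub ((affineMap a b l)^[j] z : ℝ)).const_mul l).const_sub
      ((affineMap a b l)^[j + 1] z : ℝ)

theorem mem_awaySet_of_tendsto (hk : 0 < k) (ha : a ∈ partitionPoints k) (hl0 : 0 ≤ l)
    (hl1 : l ≤ 1) {η : ℝ} (hη : 0 < η) {y : ℕ → I} (hy : ∀ q, y q ∈ awaySet a b l η) {z : I}
    (hyz : Tendsto (fun q => (y q : ℝ)) atTop (𝓝 z)) : z ∈ awaySet a b l η := fun j t ht =>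
  ge_of_tendsto' ((tendsto_iterate_of_mem_awaySet hk ha hl0 hl1 hη hy hyz j).sub_const t).abs
    fun q => hy q j t ht

/-- The number of the cell of length `η` containing a point of `I`. -/
noncomputable def cell (η : ℝ) (hη : 0 < η) (x : I) : Fin (⌊1 / η⌋₊ + 1) :=
  ⟨⌊(x : ℝ) / η⌋₊, Nat.lt_succ_of_le (Nat.floor_mono (by gcongr; exact x.2.2.le))⟩

theorem abs_sub_lt_of_cell_eq {η : ℝ} {hη : 0 < η} {x y : I} (h : cell η hη x = cell η hη y) :
    |(x : ℝ) - y| < η := by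
  have h' : ⌊(x : ℝ) / η⌋₊ = ⌊(y : ℝ) / η⌋₊ := congrArg Fin.val h
  have hx : 0 ≤ (x : ℝ) / η := div_nonneg x.2.1 hη.le
  have hy : 0 ≤ (y : ℝ) / η := div_nonneg y.2.1 hη.le
  have h1 := Nat.floor_le hx
  have h2 := Nat.lt_floor_add_one ((x : ℝ) / η)
  have h3 := Nat.floor_le hy
  have h4 := Nat.lt_floor_add_one ((y : ℝ) / η)
  rw [h'] at h1 h2
  have h5 : |(x : ℝ) / η - y / η| < 1 := abs_lt.2 ⟨by linarith, by linarith⟩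
  rwa [← sub_div, abs_div, abs_of_pos hη, div_lt_one hη] at h5

/-- Two points of an orbit in `awaySet` closer than `η` make the orbit converge to a
periodic one, as the map contracts distances less than `η` by the factor `l`. -/
theorem exists_periodic_near (hk : 0 < k) (ha : a ∈ partitionPoints k) (hl0 : 0 ≤ l)
    (hl1 : l < 1) {η : ℝ} (hη : 0 < η) {y : I} (hy : y ∈ awaySet a b l η) :
    ∃ z ∈ awaySet a b l η, z ∈ Function.periodicPts (affineMap a b l) ∧
      ∃ j, |((affineMap a b l)^[j] y : ℝ) - z| < η := by
  set f := affineMap a b l with hf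
  obtain ⟨i, j, hij, hc⟩ : ∃ i j : ℕ, i < j ∧ cell η hη (f^[i] y) = cell η hη (f^[j] y) := by
    obtain ⟨i, j, hne, h⟩ := Finite.exists_ne_map_eq_of_infinite fun j : ℕ => cell η hη (f^[j] y)
    rcases hne.lt_or_gt with h' | h'
    exacts [⟨i, j, h', h⟩, ⟨j, i, h', h.symm⟩]
  set w := f^[i] y with hw
  set p := j - i with hp
  have hp0 : 0 < p := by omega
  have hwK : w ∈ awaySet a b l η := iterate_mem_awaySet hy i
  have hj : f^[j] y = f^[p] w := by
    rw [hw, ← Function.iterate_add_apply]; congr 2; omega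
  rw [hj] at hc
  have hdist : |(w : ℝ) - f^[p] w| < η := abs_sub_lt_of_cell_eq hc
  set u : ℕ → I := fun q => f^[p * q] w with hu
  have huK : ∀ q, u q ∈ awaySet a b l η := fun q => iterate_mem_awaySet hwK _
  have hus : ∀ q, f^[p] (u q) = u (q + 1) := fun q => by
    change f^[p] (f^[p * q] w) = f^[p * (q + 1)] w
    rw [show p * (q + 1) = p + p * q by ring, Function.iterate_add_apply]
  have hcau : CauchySeq fun q => (u q : ℝ) := by
    refine cauchySeq_of_le_geometric (l ^ p) η (pow_lt_one₀ hl0 hl1 hp0.ne') fun q => ?_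
    have := iterate_sub_iterate hk ha hl0 hl1.le hwK (iterate_mem_awaySet hwK p) hdist (p * q)
    rw [dist_comm, Real.dist_eq, ← hus]
    have e : f^[p] (u q) = f^[p * q] (f^[p] w) := by
      exact Function.Commute.iterate_iterate_self f p (p * q) w
    rw [e, this, abs_mul, abs_of_nonneg (pow_nonneg hl0 _), mul_comm, ← pow_mul, abs_sub_comm]
    exact mul_le_mul_of_nonneg_right hdist.le (pow_nonneg hl0 _)
  obtain ⟨z₀, hz₀⟩ := cauchySeq_tendsto_of_complete hcau
  have hz01 : z₀ ∈ Set.Ico (0 : ℝ) 1 := by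
    refine ⟨ge_of_tendsto' hz₀ fun q => (u q).2.1, lt_of_le_of_lt ?_ (sub_lt_self 1 hη)⟩
    refine le_of_tendsto' hz₀ fun q => ?_
    have := huK q 0 1 one_mem_targets
    rw [Function.iterate_zero_apply, abs_of_neg (by linarith [(u q).2.2])] at this
    linarith
  obtain ⟨z, rfl⟩ : ∃ z : I, (z : ℝ) = z₀ := ⟨⟨z₀, hz01⟩, rfl⟩
  refine ⟨z, mem_awaySet_of_tendsto hk ha hl0 hl1.le hη huK hz₀, ⟨p, hp0, ?_⟩, ?_⟩
  · have h1 := tendsto_iterate_of_mem_awaySet hk ha hl0 hl1.le hη huK hz₀ p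
    have h2 : Tendsto (fun q => (u (q + 1) : ℝ)) atTop (𝓝 z) := hz₀.comp (tendsto_add_atTop_nat 1)
    refine Subtype.ext (tendsto_nhds_unique h1 (h2.congr fun q => ?_))
    rw [← hus]
  · have h3 := (hz₀.sub_const (z : ℝ)).abs
    rw [sub_self, abs_zero] at h3
    obtain ⟨q, hq⟩ := (h3.eventually_lt_const hη).exists
    refine ⟨p * q + i, ?_⟩
    rw [Function.iterate_add_apply]
    exact hq

/-- A sequence asymptotic to a periodic orbit has exactly this orbit as its `ω`-limit set. -/
theorem omega_eq_of_tendsto {f : I → I} {x z : I} (hz : z ∈ Function.periodicPts f) (N : ℕ)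
    (h : Tendsto (fun m => (f^[m + N] x : ℝ) - f^[m] z) atTop (𝓝 0)) :
    omega f x = Set.range fun n : ℕ => ((f^[n] z : I) : ℝ) := by
  obtain ⟨p, hp0, hp⟩ := hz
  ext c
  rw [omega, mem_omegaLimit_singleton_iff_mapClusterPt]
  constructor
  · intro hc
    have hfin : (Set.range fun n : ℕ => ((f^[n] z : I) : ℝ)).Finite := by
      refine ((Finset.range p).finite_toSet.image fun n : ℕ => ((f^[n] z : I) : ℝ)).subset ?_
      rintro _ ⟨n, rfl⟩
      exact ⟨n % p, by simpa using Nat.mod_lt n hp0, by simp only [hp.iterate_mod_apply]⟩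
    by_contra hcP
    obtain ⟨ε, hε, hball⟩ := Metric.isOpen_iff.1 hfin.isClosed.isOpen_compl c hcP
    have h1 := mapClusterPt_iff_frequently.1 hc _ (Metric.ball_mem_nhds c (half_pos hε))
    have h2 : Tendsto (fun n => (f^[n] x : ℝ) - f^[n - N] z) atTop (𝓝 0) :=
      (tendsto_add_atTop_iff_nat N).1 (by simpa using h)
    have h3 : ∀ᶠ n in atTop, |(f^[n] x : ℝ) - f^[n - N] z| < ε / 2 := by
      have := h2.abs
      rw [abs_zero] at this
      exact this.eventually_lt_const (half_pos hε)
    obtain ⟨n, hn1, hn2⟩ := (h1.and_eventually h3).exists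
    refine (?_ : ((f^[n - N] z : I) : ℝ) ∉ Metric.ball c ε) ?_
    · exact fun hmem => hball hmem ⟨n - N, rfl⟩
    rw [Metric.mem_ball, Real.dist_eq] at hn1 ⊢
    have := abs_sub_le (f^[n - N] z : ℝ) (f^[n] x) c
    rw [abs_sub_comm] at hn2
    linarith
  · rintro ⟨n, rfl⟩
    have hφ : Tendsto (fun q : ℕ => n + p * q) atTop atTop :=
      tendsto_atTop_mono (fun q => (Nat.le_mul_of_pos_left q hp0).trans (Nat.le_add_left _ _))
        tendsto_id
    refine MapClusterPt.of_comp (φ := fun q : ℕ => n + p * q + N) (p := atTop)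
      ((tendsto_add_atTop_nat N).comp hφ) (Tendsto.mapClusterPt ?_)
    have h1 := (h.comp hφ).add_const (f^[n] z : ℝ)
    rw [zero_add] at h1
    refine h1.congr fun q => ?_
    have : f^[n + p * q] z = f^[n] z := by
      rw [Function.iterate_add_apply, (hp.mul_const q).eq]
    simp [this]

/-- If all orbits eventually stay away from the endpoints of the pieces, then the map is
asymptotically periodic. -/
theorem asymptoticallyPeriodic_of_far (hk : 0 < k) (ha : a ∈ partitionPoints k) (hl0 : 0 ≤ l)
    (hl1 : l < 1) {η : ℝ} (hη : 0 < η) {n : ℕ}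
    (hfar : ∀ x : I, ∀ t ∈ targets a, η ≤ |((affineMap a b l)^[n] x : ℝ) - t|) :
    AsymptoticallyPeriodic (affineMap a b l) := by
  set f := affineMap a b l with hf
  have hK : ∀ x, f^[n] x ∈ awaySet a b l η := fun x j t ht => by
    rw [← hf, ← Function.iterate_add_apply, add_comm, Function.iterate_add_apply]
    exact hfar _ t ht
  have homega : ∀ x, ∃ z ∈ awaySet a b l η ∩ Function.periodicPts f,
      omega f x = Set.range fun n : ℕ => ((f^[n] z : I) : ℝ) := by
    intro x
    obtain ⟨z, hzK, hzp, j, hj⟩ := exists_periodic_near hk ha hl0 hl1 hη (hK x)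
    refine ⟨z, ⟨hzK, hzp⟩, omega_eq_of_tendsto hzp (j + n) ?_⟩
    have hpow := (tendsto_pow_atTop_nhds_zero_of_lt_one hl0 hl1).mul_const
      ((f^[j] (f^[n] x) : ℝ) - z)
    rw [zero_mul] at hpow
    refine hpow.congr fun m => ?_
    rw [Function.iterate_add_apply, Function.iterate_add_apply]
    exact (iterate_sub_iterate hk ha hl0 hl1.le hzK (iterate_mem_awaySet (hK x) j)
      (by rw [abs_sub_comm]; exact hj) m).symm
  refine ⟨fun x => ?_, Set.range (omega f), ?_, ?_, by rw [Set.sUnion_range]⟩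
  · obtain ⟨z, hz, h⟩ := homega x
    exact ⟨z, hz.2, h⟩
  · have hfin : (awaySet a b l η ∩ Function.periodicPts f).Finite := by
      refine Set.Finite.of_finite_image (f := cell η hη) (Set.toFinite _) ?_
      rintro y ⟨hyK, p, hp0, hp⟩ z ⟨hzK, q, hq0, hq⟩ hyz
      -- periodic points in the same cell approach each other, so they coincide
      have h1 := iterate_sub_iterate hk ha hl0 hl1.le hyK hzK (abs_sub_lt_of_cell_eq hyz) (p * q)
      rw [(hp.mul_const q).eq, (hq.const_mul p).eq] at h1
      have h2 : l ^ (p * q) < 1 := pow_lt_one₀ hl0 hl1 (by positivity)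
      have h3 : (1 - l ^ (p * q)) * ((z : ℝ) - y) = 0 := by linarith
      rcases mul_eq_zero.1 h3 with h4 | h4
      · linarith
      · exact Subtype.ext (by linarith)
    refine (hfin.image fun z => Set.range fun n : ℕ => ((f^[n] z : I) : ℝ)).subset ?_
    rintro _ ⟨x, rfl⟩
    obtain ⟨z, hz, h⟩ := homega x
    exact ⟨z, hz, h.symm⟩
  · rintro _ ⟨x, rfl⟩
    obtain ⟨z, hz, h⟩ := homega x
    exact ⟨z, hz.2, h⟩

/-! ### Digits and itineraries -/

/-- The possible values of `f x - l * x` on `I`. -/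
noncomputable def digits (b : Fin k → ℝ) : Finset ℝ :=
  (Finset.univ.image fun i => Int.fract (b i)) ∪ Finset.univ.image fun i => Int.fract (b i) - 1

theorem fract_mem_digits (i : Fin k) : Int.fract (b i) ∈ digits b :=
  Finset.mem_union_left _ (Finset.mem_image_of_mem _ (Finset.mem_univ i))

theorem fract_sub_one_mem_digits (i : Fin k) : Int.fract (b i) - 1 ∈ digits b :=
  Finset.mem_union_right _ (Finset.mem_image_of_mem _ (Finset.mem_univ i))

theorem mem_digits_iff {e : ℝ} :
    e ∈ digits b ↔ ∃ i, e = Int.fract (b i) ∨ e = Int.fract (b i) - 1 := by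
  simp only [digits, Finset.mem_union, Finset.mem_image, Finset.mem_univ, true_and, ← exists_or,
    eq_comm]

theorem abs_le_one_of_mem_digits {e : ℝ} (he : e ∈ digits b) : |e| ≤ 1 := by
  obtain ⟨i, rfl | rfl⟩ := mem_digits_iff.1 he <;>
  exact abs_le.2 ⟨by linarith [Int.fract_nonneg (b i)], by linarith [Int.fract_lt_one (b i)]⟩

/-- This is where the `ℤ`-independence of `a` and `b` enters: digits and targets are congruent
modulo `1` to entries of `b` and of `a`. -/
theorem ne_of_mem_digits_of_mem_targets (hk : 0 < k) (ha : a ∈ partitionPoints k)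
    (hab : ZIndependent a b) {e t : ℝ} (he : e ∈ digits b) (ht : t ∈ targets a) : e ≠ t := by
  obtain ⟨j, n, hj⟩ : ∃ (j : Fin k) (n : ℤ), e = b j + n := by
    obtain ⟨j, rfl | rfl⟩ := mem_digits_iff.1 he
    · exact ⟨j, -⌊b j⌋, by rw [Int.fract]; push_cast; ring⟩
    · exact ⟨j, -⌊b j⌋ - 1, by rw [Int.fract]; push_cast; ring⟩
  obtain ⟨i, m, hi⟩ : ∃ (i : Fin k) (m : ℤ), t = a i + m := by
    rcases Finset.mem_insert.1 ht with rfl | ht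
    · exact ⟨⟨0, hk⟩, 1, by rw [ha.1 ⟨0, hk⟩ rfl]; simp⟩
    · obtain ⟨i, -, rfl⟩ := Finset.mem_image.1 ht
      exact ⟨i, 0, by simp⟩
  intro h
  refine hab i j (n - m) ?_
  push_cast
  linarith

/-- The translation part of the branch `y ↦ l * y + e` of the map that is used at `x`. -/
noncomputable def digit (a b : Fin k → ℝ) (l : ℝ) (x : I) : ℝ :=
  (affineMap a b l x : ℝ) - l * x

theorem affineMap_eq_add_digit (x : I) :
    (affineMap a b l x : ℝ) = l * x + digit a b l x := by rw [digit]; ring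

theorem digit_of_lt (ha : a ∈ partitionPoints k) (hl0 : 0 ≤ l) {x : I} {i : Fin k}
    (hx : (x : ℝ) ∈ Set.Ico (a i) (rightEnd a i)) (h : l * x + Int.fract (b i) < 1) :
    digit a b l x = Int.fract (b i) := by
  rw [digit, affineMap_eq_fract_fract ha hx, Int.fract_eq_self.2 ⟨?_, h⟩]
  · ring
  · exact add_nonneg (mul_nonneg hl0 x.2.1) (Int.fract_nonneg _)

theorem digit_of_ge (ha : a ∈ partitionPoints k) (hl1 : l ≤ 1) {x : I} {i : Fin k}
    (hx : (x : ℝ) ∈ Set.Ico (a i) (rightEnd a i)) (h : 1 ≤ l * x + Int.fract (b i)) :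
    digit a b l x = Int.fract (b i) - 1 := by
  have h1 : l * x ≤ x := mul_le_of_le_one_left x.2.1 hl1
  have h2 := x.2.2
  have h3 := Int.fract_lt_one (b i)
  have : Int.fract (l * x + Int.fract (b i)) = l * x + Int.fract (b i) - 1 :=
    Int.fract_eq_iff.2 ⟨by linarith, by linarith, 1, by simp⟩
  rw [digit, affineMap_eq_fract_fract ha hx, this]
  ring

theorem digit_mem_digits (hk : 0 < k) (ha : a ∈ partitionPoints k) (hl0 : 0 ≤ l) (hl1 : l ≤ 1)
    (x : I) : digit a b l x ∈ digits b := by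
  obtain ⟨i, hi⟩ := exists_mem_piece hk ha x.2
  rcases lt_or_ge (l * x + Int.fract (b i)) 1 with h | h
  · rw [digit_of_lt ha hl0 hi h]; exact fract_mem_digits i
  · rw [digit_of_ge ha hl1 hi h]; exact fract_sub_one_mem_digits i

/-- The first `n` digits along the orbit of `x`, the last one at the head of the list. -/
noncomputable def itinerary (a b : Fin k → ℝ) (l : ℝ) : ℕ → I → List ℝ
  | 0, _ => []
  | n + 1, x => digit a b l ((affineMap a b l)^[n] x) :: itinerary a b l n x

theorem itinerary_add (m n : ℕ) (x : I) : itinerary a b l (m + n) x =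
    itinerary a b l m ((affineMap a b l)^[n] x) ++ itinerary a b l n x := by
  induction m with
  | zero => simp [itinerary]
  | succ m ih =>
    rw [Nat.add_right_comm, itinerary, ih, itinerary, List.cons_append,
      Function.iterate_add_apply]

theorem itinerary_succ (n : ℕ) (x : I) : itinerary a b l (n + 1) x =
    itinerary a b l n (affineMap a b l x) ++ [digit a b l x] := by
  rw [itinerary_add]
  rfl

theorem forall_mem_itinerary (hk : 0 < k) (ha : a ∈ partitionPoints k) (hl0 : 0 ≤ l) (hl1 : l ≤ 1)
    (n : ℕ) (x : I) : ∀ e ∈ itinerary a b l n x, e ∈ digits b := by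
  induction n with
  | zero => simp [itinerary]
  | succ n ih =>
    intro e he
    rcases List.mem_cons.1 he with rfl | he
    exacts [digit_mem_digits hk ha hl0 hl1 _, ih e he]

/-- The image of the point `t` under the branches with digits `w`, as a polynomial in the
slope. -/
noncomputable def orbitPoly (t : ℝ) : List ℝ → ℝ[X]
  | [] => C t
  | e :: w => X * orbitPoly t w + C e

theorem iterate_eq_eval_orbitPoly (n : ℕ) (x : I) :
    ((affineMap a b l)^[n] x : ℝ) = (orbitPoly x (itinerary a b l n x)).eval l := by
  induction n with
  | zero => simp [itinerary, orbitPoly]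
  | succ n ih =>
    rw [Function.iterate_succ_apply', affineMap_eq_add_digit, ih, itinerary, orbitPoly]
    simp

theorem eval_orbitPoly_sub (s t : ℝ) (w : List ℝ) :
    (orbitPoly s w).eval l - (orbitPoly t w).eval l = l ^ w.length * (s - t) := by
  induction w with
  | nil => simp [orbitPoly]
  | cons e w ih =>
    simp only [orbitPoly, eval_add, eval_mul, eval_X, eval_C, List.length_cons, pow_succ]
    linear_combination l * ih

theorem coeff_zero_orbitPoly_cons (t e : ℝ) (w : List ℝ) :
    (orbitPoly t (e :: w)).coeff 0 = e := by
  simp [orbitPoly]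

theorem abs_coeff_orbitPoly_zero_le {w : List ℝ} (hw : ∀ e ∈ w, |e| ≤ 1) (j : ℕ) :
    |(orbitPoly 0 w).coeff j| ≤ 1 := by
  induction w generalizing j with
  | nil => simp [orbitPoly]
  | cons e w ih =>
    cases j with
    | zero => rw [coeff_zero_orbitPoly_cons]; exact hw e List.mem_cons_self
    | succ j =>
      rw [orbitPoly, coeff_add, coeff_X_mul, coeff_C_succ, add_zero]
      exact ih (fun e he => hw e (List.mem_cons_of_mem _ he)) j

theorem length_itinerary (n : ℕ) (x : I) : (itinerary a b l n x).length = n := by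
  induction n with
  | zero => rfl
  | succ n ih => rw [itinerary, List.length_cons, ih]

/-- Two orbits, possibly for different slopes, with the same digits stay close. -/
theorem abs_iterate_sub_iterate_le {l' r : ℝ} (hl0 : 0 ≤ l) (hlr : l ≤ r) (hr : r < 1) {x x' : I}
    {n : ℕ} (h : itinerary a b l n x = itinerary a b l' n x') :
    |((affineMap a b l)^[n] x : ℝ) - (affineMap a b l')^[n] x'| ≤ r ^ n + |l - l'| / (1 - r) := by
  have h1r : 0 < 1 - r := by linarith
  induction n with
  | zero =>
    have : |(x : ℝ) - x'| ≤ 1 :=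
      abs_le.2 ⟨by linarith [x.2.1, x'.2.2], by linarith [x.2.2, x'.2.1]⟩
    have h0 : 0 ≤ |l - l'| / (1 - r) := by positivity
    simp only [Function.iterate_zero_apply, pow_zero]
    linarith
  | succ n ih =>
    rw [itinerary, itinerary, List.cons_eq_cons] at h
    specialize ih h.2
    rw [Function.iterate_succ_apply', Function.iterate_succ_apply', affineMap_eq_add_digit,
      affineMap_eq_add_digit, h.1]
    set y := (affineMap a b l)^[n] x
    set y' := (affineMap a b l')^[n] x'
    have e1 : l * (y : ℝ) + digit a b l' y' - (l' * y' + digit a b l' y') =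
        l * ((y : ℝ) - y') + (l - l') * y' := by ring
    have e2 : |l * ((y : ℝ) - y')| ≤ r * (r ^ n + |l - l'| / (1 - r)) := by
      rw [abs_mul, abs_of_nonneg hl0]
      exact mul_le_mul hlr ih (abs_nonneg _) (hl0.trans hlr)
    have e3 : |(l - l') * (y' : ℝ)| ≤ |l - l'| := by
      rw [abs_mul, abs_of_nonneg y'.2.1]
      exact mul_le_of_le_one_right (abs_nonneg _) y'.2.2.le
    rw [e1]
    refine (abs_add_le _ _).trans ((add_le_add e2 e3).trans (le_of_eq ?_))
    field_simp
    ring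

/-! ### Connections between endpoints -/

/-- The point `y` is the image of an endpoint of a piece under the branches of slope `l` with
digits `w`, the last one applied being the head of `w`. The branches need not be the ones that the
map itself uses along the orbit. -/
def Reachable (a b : Fin k → ℝ) (l y : ℝ) (w : List ℝ) : Prop :=
  (∀ e ∈ w, e ∈ digits b) ∧ ∃ t ∈ targets a, (orbitPoly t w).eval l = y

/-- The slopes for which some nonempty composition of branches maps an endpoint of a piece to
an endpoint of a piece. -/
def connections (a b : Fin k → ℝ) : Set ℝ :=
  {l | ∃ y ∈ targets a, ∃ w ≠ [], Reachable a b l y w}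

theorem countable_connections (hk : 0 < k) (ha : a ∈ partitionPoints k)
    (hab : ZIndependent a b) : (connections a b).Countable := by
  have hsub : connections a b ⊆ ⋃ (y : targets a) (t : targets a) (w : List (digits b))
      (_ : w ≠ []), {l | (orbitPoly t (w.map Subtype.val) - C (y : ℝ)).IsRoot l} := by
    rintro l ⟨y, hy, w, hw, hd, t, ht, h⟩
    lift w to List (digits b) using hd
    simp only [Set.mem_iUnion]
    refine ⟨⟨y, hy⟩, ⟨t, ht⟩, w, by rintro rfl; exact hw rfl, ?_⟩
    simpa [sub_eq_zero] using h
  refine Set.Countable.mono hsub ?_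
  refine Set.countable_iUnion fun y => Set.countable_iUnion fun t => Set.countable_iUnion fun w =>
    Set.countable_iUnion fun hw => (finite_setOfPred_isRoot ?_).countable
  obtain ⟨e, w, rfl⟩ := List.exists_cons_of_ne_nil hw
  intro h0
  have := congrArg (fun p => coeff p 0) h0
  simp only [List.map_cons, coeff_sub, coeff_zero_orbitPoly_cons, coeff_C_zero, coeff_zero] at this
  exact ne_of_mem_digits_of_mem_targets hk ha hab e.2 y.2 (by linarith)

theorem Reachable.cons {y e : ℝ} {w : List ℝ} (h : Reachable a b l y w) (he : e ∈ digits b) :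
    Reachable a b l (l * y + e) (e :: w) := by
  obtain ⟨hd, t, ht, rfl⟩ := h
  refine ⟨fun e' he' => ?_, t, ht, by simp [orbitPoly]⟩
  rcases List.mem_cons.1 he' with rfl | he'
  exacts [he, hd e' he']

theorem reachable_nil {t : ℝ} (ht : t ∈ targets a) : Reachable a b l t [] :=
  ⟨by simp, t, ht, by simp [orbitPoly]⟩

/-! ### Itineraries near a slope without connections -/

section LocalItineraries

variable {ι : Type*} {L : Filter ι} {lam : ι → ℝ} {x : ι → I} {y : ℝ}

theorem mem_Icc_of_tendsto [L.NeBot] (hx : Tendsto (fun j => (x j : ℝ)) L (𝓝 y)) :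
    y ∈ Set.Icc (0 : ℝ) 1 :=
  ⟨ge_of_tendsto' hx fun j => (x j).2.1, le_of_tendsto' hx fun j => (x j).2.2.le⟩

theorem tendsto_affineMap {e : ℝ} (hlam : Tendsto lam L (𝓝 l))
    (hx : Tendsto (fun j => (x j : ℝ)) L (𝓝 y)) (he : ∀ᶠ j in L, digit a b (lam j) (x j) = e) :
    Tendsto (fun j => (affineMap a b (lam j) (x j) : ℝ)) L (𝓝 (l * y + e)) := by
  refine ((hlam.mul hx).add_const e).congr' ?_
  filter_upwards [he] with j hj
  rw [affineMap_eq_add_digit, hj]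

/-- The digit is locally constant inside a piece, except where the image crosses an integer. -/
theorem eventually_digit_eq (ha : a ∈ partitionPoints k) (hl : l ∈ Set.Ioo (0 : ℝ) 1)
    (hlam : Tendsto lam L (𝓝 l)) (hx : Tendsto (fun j => (x j : ℝ)) L (𝓝 y)) {i : Fin k}
    (hi : ∀ᶠ j in L, (x j : ℝ) ∈ Set.Ico (a i) (rightEnd a i))
    (h1 : l * y + Int.fract (b i) ≠ 1) :
    ∃ e ∈ digits b, ∀ᶠ j in L, digit a b (lam j) (x j) = e := by
  have hv := (hlam.mul hx).add_const (Int.fract (b i))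
  rcases h1.lt_or_gt with h | h
  · refine ⟨_, fract_mem_digits i, ?_⟩
    filter_upwards [hi, hlam.eventually_const_lt hl.1, hv.eventually_lt_const h] with j h1 h2 h3
    exact digit_of_lt ha h2.le h1 h3
  · refine ⟨_, fract_sub_one_mem_digits i, ?_⟩
    filter_upwards [hi, hlam.eventually_lt_const hl.2, hv.eventually_const_lt h] with j h1 h2 h3
    exact digit_of_ge ha h2.le h1 h3.le

theorem eventually_mem_piece (hk : 0 < k) (ha : a ∈ partitionPoints k)
    (hx : Tendsto (fun j => (x j : ℝ)) L (𝓝 y)) (hy : y ∈ Set.Icc (0 : ℝ) 1)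
    (hyT : y ∉ targets a) : ∃ i, ∀ᶠ j in L, (x j : ℝ) ∈ Set.Ico (a i) (rightEnd a i) := by
  have hy1 : y ≠ 1 := fun h => hyT (h ▸ one_mem_targets)
  obtain ⟨i, hi⟩ := exists_mem_piece hk ha ⟨hy.1, lt_of_le_of_ne hy.2 hy1⟩
  have hne : a i ≠ y := fun h => hyT (h ▸ apply_mem_targets i)
  refine ⟨i, ?_⟩
  filter_upwards [hx.eventually_const_lt (lt_of_le_of_ne hi.1 hne), hx.eventually_lt_const hi.2]
    with j h1 h2
  exact ⟨h1.le, h2⟩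

theorem eventually_mem_piece_of_ge (hk : 0 < k) (ha : a ∈ partitionPoints k)
    (hx : Tendsto (fun j => (x j : ℝ)) L (𝓝 y)) (hy : y ∈ Set.Ico (0 : ℝ) 1)
    (hge : ∀ᶠ j in L, y ≤ x j) : ∃ i, ∀ᶠ j in L, (x j : ℝ) ∈ Set.Ico (a i) (rightEnd a i) := by
  obtain ⟨i, hi⟩ := exists_mem_piece hk ha hy
  refine ⟨i, ?_⟩
  filter_upwards [hge, hx.eventually_lt_const hi.2] with j h1 h2
  exact ⟨hi.1.trans h1, h2⟩

theorem eventually_mem_piece_of_lt (hk : 0 < k) (ha : a ∈ partitionPoints k)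
    (hx : Tendsto (fun j => (x j : ℝ)) L (𝓝 y)) (hy : y ∈ Set.Ioc (0 : ℝ) 1)
    (hlt : ∀ᶠ j in L, (x j : ℝ) < y) :
    ∃ i, ∀ᶠ j in L, (x j : ℝ) ∈ Set.Ico (a i) (rightEnd a i) := by
  have hne : (Finset.univ.filter fun i => a i < y).Nonempty :=
    ⟨⟨0, hk⟩, by simpa [ha.1 ⟨0, hk⟩ rfl] using hy.1⟩
  obtain ⟨i, hi, hmax⟩ := Finset.exists_max_image _ id hne
  have hr : y ≤ rightEnd a i := by
    unfold rightEnd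
    split_ifs with h
    · by_contra! hle
      have := hmax ⟨i.val + 1, h⟩ (Finset.mem_filter.2 ⟨Finset.mem_univ _, hle⟩)
      simp [Fin.le_def] at this
    · exact hy.2
  refine ⟨i, ?_⟩
  filter_upwards [hlt, hx.eventually_const_lt (Finset.mem_filter.1 hi).2] with j h1 h2
  exact ⟨h2.le, h1.trans_le hr⟩

/-- Along the orbit of an endpoint, no image crosses an integer if there are no connections. -/
theorem Reachable.eventually_digit_eq (ha : a ∈ partitionPoints k)
    (hl : l ∈ Set.Ioo (0 : ℝ) 1) (hconn : l ∉ connections a b) {w : List ℝ}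
    (hy : Reachable a b l y w) (hlam : Tendsto lam L (𝓝 l))
    (hx : Tendsto (fun j => (x j : ℝ)) L (𝓝 y)) {i : Fin k}
    (hi : ∀ᶠ j in L, (x j : ℝ) ∈ Set.Ico (a i) (rightEnd a i)) :
    ∃ e ∈ digits b, ∀ᶠ j in L, digit a b (lam j) (x j) = e :=
  PiecewiseAffine.eventually_digit_eq ha hl hlam hx hi fun h =>
    hconn ⟨1, one_mem_targets, _, List.cons_ne_nil _ _, h ▸ hy.cons (fract_mem_digits i)⟩

theorem eventually_itinerary_succ_eq {m : ℕ} {e : ℝ} {W : List ℝ}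
    (he : ∀ᶠ j in L, digit a b (lam j) (x j) = e)
    (hW : ∀ᶠ j in L, itinerary a b (lam j) m (affineMap a b (lam j) (x j)) = W) :
    ∀ᶠ j in L, itinerary a b (lam j) (m + 1) (x j) = W ++ [e] := by
  filter_upwards [he, hW] with j h1 h2
  rw [itinerary_succ, h1, h2]

/-- In the absence of connections, the itinerary is locally constant, in the slope and in the
point, at every point that is reached from an endpoint of a piece. -/
theorem Reachable.eventually_itinerary_eq (hk : 0 < k) (ha : a ∈ partitionPoints k)
    (hl : l ∈ Set.Ioo (0 : ℝ) 1) (hconn : l ∉ connections a b) (m : ℕ) {w : List ℝ} (hw : w ≠ [])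
    (hy : Reachable a b l y w) (hlam : Tendsto lam L (𝓝 l))
    (hx : Tendsto (fun j => (x j : ℝ)) L (𝓝 y)) :
    ∃ W, ∀ᶠ j in L, itinerary a b (lam j) m (x j) = W := by
  induction m generalizing x y w with
  | zero => exact ⟨[], by simp [itinerary]⟩
  | succ m ih =>
    rcases L.eq_or_neBot with rfl | hL
    · exact ⟨[], by simp⟩
    obtain ⟨i, hi⟩ := eventually_mem_piece hk ha hx (mem_Icc_of_tendsto hx)
      fun h => hconn ⟨y, h, w, hw, hy⟩
    obtain ⟨e, he, hev⟩ := hy.eventually_digit_eq ha hl hconn hlam hx hi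
    obtain ⟨W, hW⟩ := ih (List.cons_ne_nil e w) (hy.cons he) (tendsto_affineMap hlam hx hev)
    exact ⟨_, eventually_itinerary_succ_eq hev hW⟩

theorem eventually_itinerary_eq_of_mem_piece (hk : 0 < k) (ha : a ∈ partitionPoints k)
    (hl : l ∈ Set.Ioo (0 : ℝ) 1) (hconn : l ∉ connections a b) (m : ℕ) (hy : y ∈ targets a)
    (hlam : Tendsto lam L (𝓝 l)) (hx : Tendsto (fun j => (x j : ℝ)) L (𝓝 y)) {i : Fin k}
    (hi : ∀ᶠ j in L, (x j : ℝ) ∈ Set.Ico (a i) (rightEnd a i)) :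
    ∃ W, ∀ᶠ j in L, itinerary a b (lam j) m (x j) = W := by
  cases m with
  | zero => exact ⟨[], by simp [itinerary]⟩
  | succ m =>
    obtain ⟨e, he, hev⟩ :=
      (reachable_nil hy).eventually_digit_eq ha hl hconn hlam hx hi
    obtain ⟨W, hW⟩ := ((reachable_nil hy).cons he).eventually_itinerary_eq hk ha hl hconn m
      (List.cons_ne_nil e _) hlam (tendsto_affineMap hlam hx hev)
    exact ⟨_, eventually_itinerary_succ_eq hev hW⟩

theorem eventually_itinerary_eq_of_ge (hk : 0 < k) (ha : a ∈ partitionPoints k)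
    (hl : l ∈ Set.Ioo (0 : ℝ) 1) (hconn : l ∉ connections a b) (m : ℕ) (hy : y ∈ targets a)
    (hlam : Tendsto lam L (𝓝 l)) (hx : Tendsto (fun j => (x j : ℝ)) L (𝓝 y))
    (hge : ∀ᶠ j in L, y ≤ x j) : ∃ W, ∀ᶠ j in L, itinerary a b (lam j) m (x j) = W := by
  have hy01 := mem_Icc_of_mem_targets hk ha hy
  rcases hy01.2.eq_or_lt with h1 | h1
  · -- no point of `I` lies to the right of `1`
    refine ⟨[], hge.mono fun j hj => ?_⟩
    linarith [(x j).2.2]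
  · obtain ⟨i, hi⟩ := eventually_mem_piece_of_ge hk ha hx ⟨hy01.1, h1⟩ hge
    exact eventually_itinerary_eq_of_mem_piece hk ha hl hconn m hy hlam hx hi

theorem eventually_itinerary_eq_of_lt (hk : 0 < k) (ha : a ∈ partitionPoints k)
    (hl : l ∈ Set.Ioo (0 : ℝ) 1) (hconn : l ∉ connections a b) (m : ℕ) (hy : y ∈ targets a)
    (hlam : Tendsto lam L (𝓝 l)) (hx : Tendsto (fun j => (x j : ℝ)) L (𝓝 y))
    (hlt : ∀ᶠ j in L, (x j : ℝ) < y) : ∃ W, ∀ᶠ j in L, itinerary a b (lam j) m (x j) = W := by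
  have hy01 := mem_Icc_of_mem_targets hk ha hy
  rcases hy01.1.eq_or_lt with h1 | h1
  · -- no point of `I` lies to the left of `0`
    refine ⟨[], hlt.mono fun j hj => ?_⟩
    linarith [(x j).2.1]
  · obtain ⟨i, hi⟩ := eventually_mem_piece_of_lt hk ha hx ⟨h1, hy01.2⟩ hlt
    exact eventually_itinerary_eq_of_mem_piece hk ha hl hconn m hy hlam hx hi

/-- Near a slope without connections and near any point, at most two itineraries of length `m`
occur: an orbit segment is cut at most once, since after a cut both sides follow the orbit of an
endpoint, where itineraries are locally constant. -/
theorem exists_card_le_two_eventually_itinerary_mem (hk : 0 < k) (ha : a ∈ partitionPoints k)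
    (hl : l ∈ Set.Ioo (0 : ℝ) 1) (hconn : l ∉ connections a b) (m : ℕ)
    (hlam : Tendsto lam L (𝓝 l)) (hx : Tendsto (fun j => (x j : ℝ)) L (𝓝 y)) :
    ∃ S : Finset (List ℝ), S.card ≤ 2 ∧ ∀ᶠ j in L, itinerary a b (lam j) m (x j) ∈ S := by
  classical
  induction m generalizing x y with
  | zero => exact ⟨{[]}, by simp, by simp [itinerary]⟩
  | succ m ih =>
    rcases L.eq_or_neBot with rfl | hL
    · exact ⟨∅, by simp, by simp⟩
    by_cases hyT : y ∈ targets a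
    · obtain ⟨W₁, hW₁⟩ := eventually_itinerary_eq_of_ge (L := L ⊓ 𝓟 {j | y ≤ x j}) hk ha hl hconn
        (m + 1) hyT (hlam.mono_left inf_le_left) (hx.mono_left inf_le_left)
        (eventually_inf_principal.2 (Eventually.of_forall fun _ h => h))
      obtain ⟨W₂, hW₂⟩ := eventually_itinerary_eq_of_lt (L := L ⊓ 𝓟 {j | (x j : ℝ) < y}) hk ha hl
        hconn (m + 1) hyT (hlam.mono_left inf_le_left) (hx.mono_left inf_le_left)
        (eventually_inf_principal.2 (Eventually.of_forall fun _ h => h))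
      refine ⟨{W₁, W₂}, Finset.card_le_two, ?_⟩
      filter_upwards [eventually_inf_principal.1 hW₁, eventually_inf_principal.1 hW₂] with j h1 h2
      rcases le_or_gt y (x j) with h | h
      · simp [h1 h]
      · simp [h2 h]
    obtain ⟨i, hi⟩ := eventually_mem_piece hk ha hx (mem_Icc_of_tendsto hx) hyT
    by_cases h1 : l * y + Int.fract (b i) = 1
    · -- the image crosses an integer: one side is sent near `1`, the other near `0`
      have hl1 := hlam.eventually_lt_const hl.2
      have hl0 := hlam.eventually_const_lt hl.1
      have hd₁ : ∀ᶠ j in L ⊓ 𝓟 {j | 1 ≤ lam j * x j + Int.fract (b i)},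
          digit a b (lam j) (x j) = Int.fract (b i) - 1 := by
        rw [eventually_inf_principal]
        filter_upwards [hi, hl1] with j h1 h2 h3 using digit_of_ge ha h2.le h1 h3
      have hd₂ : ∀ᶠ j in L ⊓ 𝓟 {j | lam j * x j + Int.fract (b i) < 1},
          digit a b (lam j) (x j) = Int.fract (b i) := by
        rw [eventually_inf_principal]
        filter_upwards [hi, hl0] with j h1 h2 h3 using digit_of_lt ha h2.le h1 h3
      have ht₁ := tendsto_affineMap (hlam.mono_left inf_le_left) (hx.mono_left inf_le_left) hd₁
      have ht₂ := tendsto_affineMap (hlam.mono_left inf_le_left) (hx.mono_left inf_le_left) hd₂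
      rw [show l * y + (Int.fract (b i) - 1) = 0 by linarith] at ht₁
      rw [h1] at ht₂
      obtain ⟨W₁, hW₁⟩ := eventually_itinerary_eq_of_ge hk ha hl hconn m
        (zero_mem_targets hk ha) (hlam.mono_left inf_le_left) ht₁
        (Eventually.of_forall fun j => (affineMap a b (lam j) (x j)).2.1)
      obtain ⟨W₂, hW₂⟩ := eventually_itinerary_eq_of_lt hk ha hl hconn m
        one_mem_targets (hlam.mono_left inf_le_left) ht₂
        (Eventually.of_forall fun j => (affineMap a b (lam j) (x j)).2.2)
      refine ⟨{W₁ ++ [Int.fract (b i) - 1], W₂ ++ [Int.fract (b i)]}, Finset.card_le_two, ?_⟩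
      filter_upwards [eventually_inf_principal.1 (eventually_itinerary_succ_eq hd₁ hW₁),
        eventually_inf_principal.1 (eventually_itinerary_succ_eq hd₂ hW₂)] with j h1 h2
      rcases le_or_gt 1 (lam j * x j + Int.fract (b i)) with h | h
      · simp [h1 h]
      · simp [h2 h]
    · obtain ⟨e, -, hev⟩ := eventually_digit_eq ha hl hlam hx hi h1
      obtain ⟨S, hS, hmem⟩ := ih (tendsto_affineMap hlam hx hev)
      refine ⟨S.image fun W => W ++ [e], Finset.card_image_le.trans hS, ?_⟩
      filter_upwards [hev, hmem] with j h1 h2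
      rw [itinerary_succ, h1]
      exact Finset.mem_image_of_mem _ h2

end LocalItineraries

/-- The radius in `exists_card_le_two_eventually_itinerary_mem` can be chosen uniformly in the
point, by compactness of `[0, 1]`. -/
theorem exists_radius_card_le_two (hk : 0 < k) (ha : a ∈ partitionPoints k)
    (hl : l ∈ Set.Ioo (0 : ℝ) 1) (hconn : l ∉ connections a b) (m : ℕ) :
    ∃ ε > 0, ∀ x₀ : I, ∃ S : Finset (List ℝ), S.card ≤ 2 ∧ ∀ l' : ℝ, |l' - l| < ε →
      ∀ x : I, |(x : ℝ) - x₀| < ε → itinerary a b l' m x ∈ S := by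
  have hloc : ∀ y : ℝ, ∃ S : Finset (List ℝ), S.card ≤ 2 ∧ ∃ δ > 0, ∀ l' : ℝ, ∀ x : I,
      (l', (x : ℝ)) ∈ Metric.ball (l, y) δ → itinerary a b l' m x ∈ S := by
    intro y
    obtain ⟨S, hS, hev⟩ := exists_card_le_two_eventually_itinerary_mem
      (L := comap (fun p : ℝ × I => (p.1, (p.2 : ℝ))) (𝓝 (l, y))) (lam := Prod.fst) (x := Prod.snd)
      hk ha hl hconn m
      (continuous_fst.continuousAt.tendsto.comp tendsto_comap)
      (continuous_snd.continuousAt.tendsto.comp tendsto_comap)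
    obtain ⟨U, hU, hsub⟩ := mem_comap.1 hev
    obtain ⟨δ, hδ, hball⟩ := Metric.mem_nhds_iff.1 hU
    exact ⟨S, hS, δ, hδ, fun l' x h => hsub (a := (l', x)) (hball h)⟩
  choose S hS δ hδ h using hloc
  obtain ⟨ε, hε, hleb⟩ := lebesgue_number_lemma_of_metric
    (s := {l} ×ˢ Set.Icc (0 : ℝ) 1) (c := fun y : ℝ => Metric.ball (l, y) (δ y))
    (isCompact_singleton.prod isCompact_Icc) (fun _ => Metric.isOpen_ball) (by
      rintro ⟨l', y⟩ ⟨rfl, -⟩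
      exact Set.mem_iUnion.2 ⟨y, Metric.mem_ball_self (hδ y)⟩)
  refine ⟨ε, hε, fun x₀ => ?_⟩
  obtain ⟨y, hy⟩ := hleb (l, x₀) ⟨rfl, x₀.2.1, x₀.2.2.le⟩
  refine ⟨S y, hS y, fun l' hl' x hx => h y l' x (hy ?_)⟩
  rw [Metric.mem_ball, Prod.dist_eq, max_lt_iff]
  exact ⟨hl', hx⟩

/-! ### Growth of the number of itineraries -/

theorem exists_finset_itinerary_mem (hk : 0 < k) (ha : a ∈ partitionPoints k) (n : ℕ) :
    ∃ W : Finset (List ℝ), ∀ l' ∈ Set.Ioo (0 : ℝ) 1, ∀ x : I, itinerary a b l' n x ∈ W := by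
  classical
  induction n with
  | zero => exact ⟨{[]}, fun _ _ _ => by simp [itinerary]⟩
  | succ n ih =>
    obtain ⟨W, hW⟩ := ih
    exact ⟨Finset.image₂ List.cons (digits b) W, fun l' hl' x =>
      Finset.mem_image₂_of_mem (digit_mem_digits hk ha hl'.1.le hl'.2.le _) (hW l' hl' x)⟩

/-- Near a slope without connections, the number of itineraries, for all slopes and all points
together, at most doubles every `m` steps. -/
theorem exists_itinerary_growth (hk : 0 < k) (ha : a ∈ partitionPoints k) {r : ℝ}
    (hl0 : 0 < l) (hlr : l < r) (hr : r < 1) (hconn : l ∉ connections a b) (m : ℕ) :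
    ∃ ρ > 0, ∃ n₀ K : ℕ, ∀ q : ℕ, ∃ W : Finset (List ℝ), W.card ≤ K * 2 ^ q ∧
      ∀ l' ∈ Set.Ioo 0 r, |l' - l| < ρ → ∀ x : I, itinerary a b l' (n₀ + m * q) x ∈ W := by
  classical
  have h1r : 0 < 1 - r := by linarith
  have hr0 : 0 < r := hl0.trans hlr
  obtain ⟨ε, hε, hloc⟩ := exists_radius_card_le_two hk ha ⟨hl0, hlr.trans hr⟩ hconn m
  obtain ⟨n₀, hn₀⟩ := exists_pow_lt_of_lt_one (half_pos hε) hr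
  obtain ⟨W₀, hW₀⟩ := exists_finset_itinerary_mem (b := b) hk ha n₀
  refine ⟨min ε ((1 - r) * ε / 4), by positivity, n₀, W₀.card, fun q => ?_⟩
  induction q with
  | zero =>
    refine ⟨W₀, by simp, fun l' hl' _ x => ?_⟩
    rw [mul_zero, add_zero]
    exact hW₀ l' ⟨hl'.1, hl'.2.trans hr⟩ x
  | succ q ih =>
    obtain ⟨W, hWc, hW⟩ := ih
    set n := n₀ + m * q with hn
    have hcont : ∀ w : List ℝ, ∃ S : Finset (List ℝ), S.card ≤ 2 ∧ ∀ l' ∈ Set.Ioo 0 r,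
        |l' - l| < min ε ((1 - r) * ε / 4) → ∀ x : I, itinerary a b l' n x = w →
          itinerary a b l' m ((affineMap a b l')^[n] x) ∈ S := by
      intro w
      by_cases hex : ∃ l₁ ∈ Set.Ioo 0 r, |l₁ - l| < min ε ((1 - r) * ε / 4) ∧
          ∃ x₁ : I, itinerary a b l₁ n x₁ = w
      · obtain ⟨l₁, hl₁, hd₁, x₁, hx₁⟩ := hex
        obtain ⟨S, hS, hmem⟩ := hloc ((affineMap a b l₁)^[n] x₁)
        refine ⟨S, hS, fun l' hl' hd x hx => hmem l' (hd.trans_le (min_le_left _ _)) _ ?_⟩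
        refine (abs_iterate_sub_iterate_le hl'.1.le hl'.2.le hr (hx.trans hx₁.symm)).trans_lt ?_
        have e1 : r ^ n ≤ r ^ n₀ := pow_le_pow_of_le_one hr0.le hr.le (Nat.le_add_right _ _)
        have e2 : |l' - l₁| / (1 - r) < ε / 2 := by
          rw [div_lt_iff₀ h1r]
          have := abs_sub_le l' l l₁
          rw [abs_sub_comm l l₁] at this
          have h3 := hd.trans_le (min_le_right _ _)
          have h4 := hd₁.trans_le (min_le_right _ _)
          linarith
        linarith
      · refine ⟨∅, by simp, fun l' hl' hd x hx => (hex ⟨l', hl', hd, x, hx⟩).elim⟩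
    choose S hS hSmem using hcont
    refine ⟨W.biUnion fun w => (S w).image fun v => v ++ w, ?_, fun l' hl' hd x => ?_⟩
    · refine (Finset.card_biUnion_le_card_mul _ _ 2 fun w _ =>
        Finset.card_image_le.trans (hS w)).trans ?_
      rw [pow_succ, ← mul_assoc]
      exact Nat.mul_le_mul_right 2 hWc
    · rw [show n₀ + m * (q + 1) = m + n by rw [hn]; ring, itinerary_add]
      exact Finset.mem_biUnion.2 ⟨_, hW l' hl' hd x,
        Finset.mem_image_of_mem _ (hSmem _ l' hl' hd x rfl)⟩

/-! ### Covering the exceptional slopes -/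

theorem hausdorffMeasure_eq_zero_of_covers {s : Set ℝ} {d : ℝ} (hd : 0 ≤ d) (F : ℕ → Finset ℝ)
    {τ : ℕ → ℝ} (hτ0 : ∀ q, 0 ≤ τ q) (hτ : Tendsto τ atTop (𝓝 0))
    (hcov : ∀ᶠ q in atTop, s ⊆ ⋃ x ∈ F q, Metric.closedBall x (τ q))
    (hsum : Tendsto (fun q => (F q).card * (2 * τ q) ^ d) atTop (𝓝 0)) : μH[d] s = 0 := by
  have hdiam : ∀ q (x : ℝ),
      Metric.ediam (Metric.closedBall x (τ q)) = ENNReal.ofReal (2 * τ q) := by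
    intro q x
    rw [Real.closedBall_eq_Icc, Real.ediam_Icc]
    congr 1
    ring
  have hr : Tendsto (fun q => ENNReal.ofReal (2 * τ q)) atTop (𝓝 0) := by
    have := ENNReal.tendsto_ofReal (hτ.const_mul 2)
    rwa [mul_zero, ENNReal.ofReal_zero] at this
  have hle := Measure.hausdorffMeasure_le_liminf_sum d s (ι := fun q => F q) _ hr
    (fun q x => Metric.closedBall (x : ℝ) (τ q))
    (Eventually.of_forall fun q x => (hdiam q x).le) (by
      filter_upwards [hcov] with q hq
      intro x hx
      simpa using hq hx)
  refine le_antisymm (hle.trans (le_of_eq ?_)) zero_le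
  have h0 := ENNReal.tendsto_ofReal hsum
  rw [ENNReal.ofReal_zero] at h0
  refine Tendsto.liminf_eq (h0.congr fun q => ?_)
  have h2 : 0 ≤ 2 * τ q := mul_nonneg zero_le_two (hτ0 q)
  simp only [hdiam, Finset.sum_const, Finset.card_univ, Fintype.card_coe, nsmul_eq_mul]
  rw [ENNReal.ofReal_mul (Nat.cast_nonneg _), ENNReal.ofReal_natCast,
    ENNReal.ofReal_rpow_of_nonneg h2 hd]

/-- The set of slopes for which the branches with digits `w` bring the orbits close to an endpoint
`t` is covered by `M` small intervals: the relevant polynomial has bounded coefficients, and its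
constant coefficient is bounded away from `0` because no digit is an endpoint. -/
theorem exists_cover_near_target {r R δ τ ε t : ℝ} {M : ℕ} {w : List ℝ} (hr0 : 0 < r)
    (hrR : r ≤ R) (hR : R < 1) (hM : 2 / (1 - R) * (r / R) ^ M ≤ δ / 2) (hτ0 : 0 < τ)
    (hτ1 : τ ≤ 1) (hε : 0 ≤ ε) (hτ : 4 * M * ε * 2 ^ M < δ * τ ^ M) (hw : w ≠ [])
    (hw1 : ∀ e ∈ w, |e| ≤ 1) (hwδ : ∀ e ∈ w, δ ≤ |e - t|) (ht : |t| ≤ 1) :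
    ∃ F : Finset ℝ, F.card ≤ M ∧
      {x | x ∈ Set.Icc 0 r ∧ |(orbitPoly 0 w).eval x - t| ≤ ε} ⊆
        ⋃ x ∈ F, Metric.closedBall x τ := by
  refine exists_finset_cover_of_separated hτ0.le fun s hs hsep hcard => ?_
  subst hcard
  refine hτ.not_ge (separation_pow_le (g := orbitPoly 0 w - C t) (B := 2) (fun j => ?_) ?_ hrR
    (hr0.trans_le hrR) hR (fun x hx => (hs x hx).1) hτ0 hτ1 hε hsep (fun x hx => ?_) hM)
  · have h1 := abs_coeff_orbitPoly_zero_le hw1 j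
    have h2 : |(C t : ℝ[X]).coeff j| ≤ 1 := by
      rw [coeff_C]
      split_ifs
      exacts [ht, by simp]
    rw [coeff_sub]
    exact (abs_sub _ _).trans (by linarith)
  · obtain ⟨e, w, rfl⟩ := List.exists_cons_of_ne_nil hw
    rw [coeff_sub, coeff_zero_orbitPoly_cons, coeff_C_zero]
    exact hwδ e List.mem_cons_self
  · simpa using (hs x hx).2

theorem exists_near_target_of_mem_exceptionalSlopes (hk : 0 < k) (ha : a ∈ partitionPoints k)
    (hl : l ∈ exceptionalSlopes a b) {η : ℝ} (hη : 0 < η) (n : ℕ) :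
    ∃ x : I, ∃ t ∈ targets a, |((affineMap a b l)^[n] x : ℝ) - t| < η := by
  by_contra! h
  exact hl.2 (asymptoticallyPeriodic_of_far hk ha hl.1.1.le hl.1.2 hη h)

theorem exists_le_abs_digit_sub_target (hk : 0 < k) (ha : a ∈ partitionPoints k)
    (hab : ZIndependent a b) :
    ∃ δ > 0, ∀ e ∈ digits b, ∀ t ∈ targets a, δ ≤ |e - t| := by
  have hne : (digits b ×ˢ targets a).Nonempty :=
    ⟨(Int.fract (b ⟨0, hk⟩), 1), Finset.mk_mem_product (fract_mem_digits _) one_mem_targets⟩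
  obtain ⟨p, hp, hmin⟩ := Finset.exists_min_image _ (fun p : ℝ × ℝ => |p.1 - p.2|) hne
  rw [Finset.mem_product] at hp
  exact ⟨|p.1 - p.2|,
    abs_pos.2 (sub_ne_zero.2 (ne_of_mem_digits_of_mem_targets hk ha hab hp.1 hp.2)),
    fun e he t ht => hmin (e, t) (Finset.mk_mem_product he ht)⟩

/-- A cover of the exceptional slopes among those whose itineraries of length `n` lie in `W`. -/
theorem exists_cover_exceptionalSlopes (hk : 0 < k) (ha : a ∈ partitionPoints k) {r R δ τ : ℝ}
    {M n : ℕ} (hδ : ∀ e ∈ digits b, ∀ t ∈ targets a, δ ≤ |e - t|) (hr0 : 0 < r) (hrR : r ≤ R)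
    (hR : R < 1) (hM : 2 / (1 - R) * (r / R) ^ M ≤ δ / 2) (hτ0 : 0 < τ) (hτ1 : τ ≤ 1)
    (hτ : 4 * M * (2 * r ^ n) * 2 ^ M < δ * τ ^ M) (hn : n ≠ 0) {s : Set ℝ}
    (hs : s ⊆ exceptionalSlopes a b) (hsr : ∀ l ∈ s, l ≤ r) {W : Finset (List ℝ)}
    (hW : ∀ l ∈ s, ∀ x, itinerary a b l n x ∈ W) :
    ∃ F : Finset ℝ, F.card ≤ W.card * (targets a).card * M ∧
      s ⊆ ⋃ x ∈ F, Metric.closedBall x τ := by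
  classical
  have hF : ∀ p ∈ W ×ˢ targets a, ∃ F : Finset ℝ, F.card ≤ M ∧
      (p.1 ≠ [] → (∀ e ∈ p.1, e ∈ digits b) →
        {x | x ∈ Set.Icc 0 r ∧ |(orbitPoly 0 p.1).eval x - p.2| ≤ 2 * r ^ n} ⊆
          ⋃ x ∈ F, Metric.closedBall x τ) := by
    intro p hp
    have ht := (Finset.mem_product.1 hp).2
    by_cases hp' : p.1 ≠ [] ∧ ∀ e ∈ p.1, e ∈ digits b
    · have ht01 := mem_Icc_of_mem_targets hk ha ht
      obtain ⟨F, hF, hsub⟩ := exists_cover_near_target hr0 hrR hR hM hτ0 hτ1 (by positivity) hτ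
        hp'.1 (fun e he => abs_le_one_of_mem_digits (hp'.2 e he))
        (fun e he => hδ e (hp'.2 e he) _ ht) (by rw [abs_of_nonneg ht01.1]; exact ht01.2)
      exact ⟨F, hF, fun _ _ => hsub⟩
    · exact ⟨∅, by simp, fun h1 h2 => (hp' ⟨h1, h2⟩).elim⟩
  choose! F hFc hFsub using hF
  refine ⟨(W ×ˢ targets a).biUnion F, ?_, fun l hl => ?_⟩
  · rw [← Finset.card_product]
    exact Finset.card_biUnion_le_card_mul _ _ _ hFc
  · have hexc := hs hl
    have hl0 := hexc.1.1.le
    obtain ⟨x, t, ht, hxt⟩ :=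
      exists_near_target_of_mem_exceptionalSlopes hk ha hexc (pow_pos hr0 n) n
    have hp : (itinerary a b l n x, t) ∈ W ×ˢ targets a :=
      Finset.mk_mem_product (hW l hl x) ht
    have hne : itinerary a b l n x ≠ [] := fun h => hn (by rw [← length_itinerary n x, h]; rfl)
    have hdist : |(orbitPoly 0 (itinerary a b l n x)).eval l - t| ≤ 2 * r ^ n := by
      have h1 := eval_orbitPoly_sub (l := l) 0 x (itinerary a b l n x)
      rw [← iterate_eq_eval_orbitPoly, length_itinerary] at h1
      have h2 : l ^ n * x ≤ r ^ n :=
        (mul_le_of_le_one_right (pow_nonneg hl0 n) x.2.2.le).trans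
          (pow_le_pow_left₀ hl0 (hsr l hl) n)
      have h3 : 0 ≤ l ^ n * x := mul_nonneg (pow_nonneg hl0 n) x.2.1
      rw [abs_lt] at hxt
      rw [abs_le]
      constructor <;> linarith [hxt.1, hxt.2]
    obtain ⟨c, hc⟩ := Set.mem_iUnion.1 (hFsub _ hp hne
      (forall_mem_itinerary hk ha hl0 hexc.1.2.le n x) ⟨⟨hl0, hsr l hl⟩, hdist⟩)
    obtain ⟨hcF, hc⟩ := Set.mem_iUnion.1 hc
    exact Set.mem_biUnion (Finset.mem_biUnion.2 ⟨_, hp, hcF⟩) hc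

/-- The local statement: near a slope without connections, the exceptional slopes have
`d`-dimensional Hausdorff measure zero. -/
theorem exists_hausdorffMeasure_eq_zero (hk : 0 < k) (ha : a ∈ partitionPoints k)
    (hab : ZIndependent a b) (hl : l ∈ Set.Ioo (0 : ℝ) 1) (hconn : l ∉ connections a b) {d : ℝ}
    (hd : 0 < d) : ∃ U ∈ 𝓝 l, μH[d] (exceptionalSlopes a b ∩ U) = 0 := by
  obtain ⟨δ, hδ0, hδ⟩ := exists_le_abs_digit_sub_target hk ha hab
  obtain ⟨r, hlr, hr⟩ := exists_between hl.2
  obtain ⟨R, hrR, hR⟩ := exists_between hr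
  have hr0 : 0 < r := hl.1.trans hlr
  have hR0 : 0 < R := hr0.trans hrR
  -- the number `M` of intervals for each polynomial depends on `r`, but not on `d`
  obtain ⟨M, hM, hM1⟩ : ∃ M : ℕ, 2 / (1 - R) * (r / R) ^ M ≤ δ / 2 ∧ 1 ≤ M := by
    have := (tendsto_pow_atTop_nhds_zero_of_lt_one (div_nonneg hr0.le hR0.le)
      ((div_lt_one hR0).2 hrR)).const_mul (2 / (1 - R))
    rw [mul_zero] at this
    exact ((this.eventually_le_const (half_pos hδ0)).and (eventually_ge_atTop 1)).exists
  have hM0 : M ≠ 0 := by omega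
  set θ : ℝ := r ^ ((M : ℝ)⁻¹) with hθ
  have hθ0 : 0 < θ := Real.rpow_pos_of_pos hr0 _
  have hθM : θ ^ M = r := Real.rpow_inv_natCast_pow hr0.le hM0
  have hθ1 : θ < 1 := Real.rpow_lt_one hr0.le hr (by positivity)
  set A : ℝ := 8 * M * 2 ^ M / δ + 1 with hA
  have hA1 : 1 ≤ A := by rw [hA]; linarith [show 0 ≤ 8 * M * 2 ^ M / δ by positivity]
  have hA0 : 0 < A := by linarith
  have hAM : 8 * M * 2 ^ M < δ * A ^ M := by
    have h1 : A ≤ A ^ M := le_self_pow₀ hA1 hM0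
    have h2 : 8 * M * 2 ^ M < δ * A := by
      rw [hA, mul_add, mul_div_cancel₀ _ hδ0.ne']
      linarith
    exact h2.trans_le (mul_le_mul_of_nonneg_left h1 hδ0.le)
  -- `m` is chosen so that the shrinking of the intervals over `m` steps beats the factor `2`
  obtain ⟨m, hm, hm1⟩ : ∃ m : ℕ, 2 * (θ ^ d) ^ m < 1 ∧ 1 ≤ m := by
    have := (tendsto_pow_atTop_nhds_zero_of_lt_one (Real.rpow_nonneg hθ0.le d)
      (Real.rpow_lt_one hθ0.le hθ1 hd)).const_mul 2
    rw [mul_zero] at this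
    exact ((this.eventually_lt_const one_pos).and (eventually_ge_atTop 1)).exists
  obtain ⟨ρ, hρ, n₀, K, hgrowth⟩ := exists_itinerary_growth hk ha hl.1 hlr hr hconn m
  choose W hWc hW using hgrowth
  refine ⟨Set.Iio r ∩ Metric.ball l ρ, inter_mem (Iio_mem_nhds hlr) (Metric.ball_mem_nhds l hρ),
    ?_⟩
  set s := exceptionalSlopes a b ∩ (Set.Iio r ∩ Metric.ball l ρ) with hs
  set τ : ℕ → ℝ := fun q => A * θ ^ (n₀ + m * q) with hτ
  have hτ0 : ∀ q, 0 < τ q := fun q => by positivity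
  have hτlim : Tendsto τ atTop (𝓝 0) := by
    have h1 : Tendsto (fun q : ℕ => n₀ + m * q) atTop atTop :=
      tendsto_atTop_mono (fun q => (Nat.le_mul_of_pos_left q hm1).trans (Nat.le_add_left _ _))
        tendsto_id
    have := ((tendsto_pow_atTop_nhds_zero_of_lt_one hθ0.le hθ1).comp h1).const_mul A
    rwa [mul_zero] at this
  have hcover : ∀ q, ∃ F : Finset ℝ, F.card ≤ (W q).card * (targets a).card * M ∧
      (τ q ≤ 1 → n₀ + m * q ≠ 0 → s ⊆ ⋃ x ∈ F, Metric.closedBall x (τ q)) := by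
    intro q
    by_cases hq : τ q ≤ 1 ∧ n₀ + m * q ≠ 0
    · have hlt : 4 * M * (2 * r ^ (n₀ + m * q)) * 2 ^ M < δ * τ q ^ M := by
        rw [hτ, mul_pow, ← pow_mul, mul_comm _ M, pow_mul, hθM]
        nlinarith [mul_lt_mul_of_pos_right hAM (pow_pos hr0 (n₀ + m * q))]
      obtain ⟨F, hF, hsub⟩ := exists_cover_exceptionalSlopes hk ha hδ hr0 hrR.le hR hM (hτ0 q)
        hq.1 hlt hq.2 (s := s) (W := W q)
        Set.inter_subset_left (fun l' hl' => (Set.mem_Iio.1 hl'.2.1).le)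
        (fun l' hl' => hW q l' ⟨hl'.1.1.1, hl'.2.1⟩ hl'.2.2)
      exact ⟨F, hF, fun _ _ => hsub⟩
    · exact ⟨∅, by simp, fun h1 h2 => (hq ⟨h1, h2⟩).elim⟩
  choose F hFc hFsub using hcover
  refine hausdorffMeasure_eq_zero_of_covers hd.le F (fun q => (hτ0 q).le) hτlim ?_ ?_
  · filter_upwards [hτlim.eventually_le_const one_pos, eventually_ge_atTop 1] with q h1 h2
    exact hFsub q h1 (by have := Nat.mul_pos hm1 h2; omega)
  · have hlim := (tendsto_pow_atTop_nhds_zero_of_lt_one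
      (mul_nonneg zero_le_two (pow_nonneg (Real.rpow_nonneg hθ0.le d) m)) hm).const_mul
      (K * (targets a).card * M * (2 * A * θ ^ n₀) ^ d)
    rw [mul_zero] at hlim
    refine squeeze_zero (fun q => by have := hτ0 q; positivity) (fun q => ?_) hlim
    have h1 : ((F q).card : ℝ) ≤ K * 2 ^ q * (targets a).card * M := by
      have := (hFc q).trans (Nat.mul_le_mul_right M (Nat.mul_le_mul_right _ (hWc q)))
      exact_mod_cast this
    have h2 : (2 * τ q) ^ d = (2 * A * θ ^ n₀) ^ d * ((θ ^ d) ^ m) ^ q := by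
      rw [hτ, show 2 * (A * θ ^ (n₀ + m * q)) = (2 * A * θ ^ n₀) * θ ^ (m * q) by ring,
        Real.mul_rpow (by positivity) (by positivity), ← pow_mul, ← Real.rpow_natCast (θ ^ d),
        ← Real.rpow_natCast θ (m * q), ← Real.rpow_mul hθ0.le, ← Real.rpow_mul hθ0.le,
        mul_comm d]
    rw [h2, mul_pow]
    refine (mul_le_mul_of_nonneg_right h1 (by positivity)).trans (le_of_eq ?_)
    ring

theorem dimH_exceptionalSlopes_diff_connections (hk : 0 < k) (ha : a ∈ partitionPoints k)
    (hab : ZIndependent a b) : dimH (exceptionalSlopes a b \ connections a b) = 0 := by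
  by_contra! hne
  obtain ⟨d, hd0, hd⟩ := ENNReal.lt_iff_exists_nnreal_btwn.1 (pos_iff_ne_zero.2 hne)
  obtain ⟨l, hl, hloc⟩ := exists_mem_nhdsWithin_lt_dimH_of_lt_dimH hd
  have hd0' : (0 : ℝ) < d := by exact_mod_cast hd0
  obtain ⟨U, hU, hzero⟩ := exists_hausdorffMeasure_eq_zero hk ha hab hl.1.1 hl.2 hd0'
  have h1 := hloc _ (inter_mem self_mem_nhdsWithin (mem_nhdsWithin_of_mem_nhds hU))
  refine h1.not_ge ((dimH_mono (Set.inter_subset_inter_left U Set.sdiff_subset)).trans ?_)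
  exact dimH_le_of_hausdorffMeasure_ne_top (by rw [hzero]; exact ENNReal.zero_ne_top)

theorem dimH_exceptionalSlopes (hk : 0 < k) (ha : a ∈ partitionPoints k)
    (hab : ZIndependent a b) : dimH (exceptionalSlopes a b) = 0 := by
  refine le_antisymm ((dimH_mono (Set.subset_sdiff_union _ (connections a b))).trans ?_) zero_le
  rw [dimH_union, dimH_exceptionalSlopes_diff_connections hk ha hab,
    dimH_countable (countable_connections hk ha hab), max_self]

end PiecewiseAffine

theorem theorem1p2 (k : ℕ) (hk : 0 < k) (a b : Fin k → ℝ)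
    (ha : a ∈ PiecewiseAffine.partitionPoints k) (hab : PiecewiseAffine.ZIndependent a b) :
    dimH (PiecewiseAffine.exceptionalSlopes a b) = 0 :=
  PiecewiseAffine.dimH_exceptionalSlopes hk ha hab
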